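/- Let $\delta>-\tfrac12$, let $\mu\ge 1$ be an integer, let $g_2$ be real-valued and analytic on $[-1,1]$, and let $$f(x)=(1+x)^{\delta}\,\ln^{\mu}(1+x)\,g_2(x),\qquad -1<x\le 1 .$$ Then the integrals defining the Chebyshev coefficients $$a_k=\frac{2}{\pi}\int_{-1}^{1}\frac{f(x)\,T_k(x)}{\sqrt{1-x^2}}\,dx\qquad(k=0,1,2,\dots)$$ converge absolutely, and, as $k\to\infty$, $$\begin{aligned} a_k={}&\frac{2^{\mu+1-\delta}}{\pi}\,g_2(-1)\,(-1)^{k+\mu+1}\sin(\delta\pi)\,\Gamma(2\delta+1)\,\frac{\ln^{\mu}k}{k^{2\delta+1}}\\ &+(-1)^{k+\mu}\,\mu\,2^{\mu-\delta}\,g_2(-1)\left(\frac{2}{\pi}\sin(\delta\pi)\,\Gamma'(2\delta+1)+\Bigl(\cos(\delta\pi)-\frac{\ln 2}{\pi}\sin(\delta\pi)\Bigr)\Gamma(2\delta+1)\right)\frac{\ln^{\mu-1}k}{k^{2\delta+1}}\\ &+\mathcal O\!\left(\frac{\ln^{\mu-2}k}{k^{2\delta+1}}\right), \end{aligned}$$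 where the constant implied by $\mathcal O$ may depend on $\delta,\mu,g_2$. -/

import Mathlib

open scoped Asymptotics

/-- The `k`-th Chebyshev coefficient `a_k = (2/π) ∫_{-1}^{1} f(x) T_k(x) / √(1 - x²) dx` of `f`. -/
noncomputable def chebyshevCoeff (f : ℝ → ℝ) (k : ℕ) : ℝ :=
  2 / Real.pi * ∫ x in (-1 : ℝ)..1,
    f x * (Polynomial.Chebyshev.T ℝ (k : ℤ)).eval x / Real.sqrt (1 - x ^ 2)

/-- The two explicit terms of the asymptotic expansion of the Chebyshev coefficients of
`(1 + x) ^ δ * log (1 + x) ^ μ * g x`, where `c` stands for the value `g (-1)`. -/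
noncomputable def chebyshevTwoTerm (δ : ℝ) (μ : ℕ) (c : ℝ) (k : ℕ) : ℝ :=
  (2 : ℝ) ^ ((μ : ℝ) + 1 - δ) / Real.pi * c * (-1) ^ (k + μ + 1) * Real.sin (δ * Real.pi)
      * Real.Gamma (2 * δ + 1) * (Real.log k ^ μ / (k : ℝ) ^ (2 * δ + 1))
    + (-1) ^ (k + μ) * (μ : ℝ) * (2 : ℝ) ^ ((μ : ℝ) - δ) * c
      * (2 / Real.pi * Real.sin (δ * Real.pi) * deriv Real.Gamma (2 * δ + 1)
          + (Real.cos (δ * Real.pi) - Real.log 2 / Real.pi * Real.sin (δ * Real.pi))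
            * Real.Gamma (2 * δ + 1))
      * (Real.log k ^ (μ - 1) / (k : ℝ) ^ (2 * δ + 1))

namespace ChebyshevLog

open Set MeasureTheory Filter Topology

/-! The substitution `x = -cos t` turns `a_k` into `(2/π)(-1)^k` times the integral over `(0, π)` of
`(1 - cos t)^δ log^μ(1 - cos t) g(-cos t) cos(kt)`. Writing `g(x) = g(-1) + (1 + x) q(x)` with `q`
analytic isolates a model integral; the rest has `δ + 1` in place of `δ`, hence is `O(k^(-(2δ+2)))`,
smaller than the error term.

The model integral is the `μ`-th derivative in `s` of `I_k(s) = ∫ (1 - cos t)^s cos(kt) dt`,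
holomorphic for `Re s > -1/2`. A recurrence in `k` (`versineIntegral_succ`) and a Beta integral for
`I_0` give `I_k` as an explicit product. Euler's limit for Gamma, reflection and duplication then
show that `k^(2s+1) I_k(s)` tends to `L(s) = -2^(-s) Γ(2s+1) sin(πs)`, with error `O(1/k)` uniformly
on compact sets (`exists_norm_cpow_mul_versineIntegral_sub_le`).

By Cauchy's estimates the same rate holds for all `s`-derivatives. In Leibniz' rule for `k^(-(2s+1))
· (k^(2s+1) I_k(s))` each derivative of the first factor yields `-2 log k`, so the two highest
powers of `log k` carry `L` and `L'` (`versineIntegral_expansion`): these are the two explicit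
terms. -/

/-! ### Integrable bounds at the endpoint singularity -/

lemma one_sub_cos_pos {t : ℝ} (ht : t ∈ Ioo 0 Real.pi) : 0 < 1 - Real.cos t := by
  have := Real.cos_lt_cos_of_nonneg_of_le_pi le_rfl ht.2.le ht.1
  rw [Real.cos_zero] at this
  linarith

lemma one_sub_cos_le_two (t : ℝ) : 1 - Real.cos t ≤ 2 := by
  linarith [Real.neg_one_le_cos t]

lemma abs_log_le_rpow_neg {η y : ℝ} (hη : 0 < η) (hy : 0 < y) (hy2 : y ≤ 2) :
    |Real.log y| ≤ (1 + 4 ^ η) / η * y ^ (-η) := by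
  have h1 : Real.log y ≤ y ^ η / η := Real.log_le_rpow_div hy.le hη
  have h2 : -Real.log y ≤ y ^ (-η) / η := by
    rw [← Real.log_inv, Real.rpow_neg hy.le, ← Real.inv_rpow hy.le]
    exact Real.log_le_rpow_div (inv_nonneg.2 hy.le) hη
  have hp : 0 < y ^ (-η) := Real.rpow_pos_of_pos hy _
  have h3 : y ^ η ≤ 4 ^ η * y ^ (-η) := by
    have : y ^ η = y ^ (2 * η) * y ^ (-η) := by
      rw [← Real.rpow_add hy]; ring_nf
    rw [this]
    gcongr
    calc y ^ (2 * η) ≤ 2 ^ (2 * η) := Real.rpow_le_rpow hy.le hy2 (by positivity)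
      _ = 4 ^ η := by rw [Real.rpow_mul (by norm_num)]; norm_num
  have h4 : (0 : ℝ) < 4 ^ η := by positivity
  have h5 : (1 + 4 ^ η) / η * y ^ (-η) = (y ^ (-η) + 4 ^ η * y ^ (-η)) / η := by ring
  rw [h5, abs_le']
  constructor
  · refine h1.trans ?_
    gcongr
    linarith
  · refine h2.trans ?_
    gcongr
    nlinarith

lemma exists_rpow_mul_log_pow_le {σ : ℝ} (hσ : -(1 / 2) < σ) (j : ℕ) :
    ∃ C p : ℝ, 0 ≤ C ∧ -1 < p ∧ ∀ t ∈ Ioo 0 Real.pi,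
      (1 - Real.cos t) ^ σ * |Real.log (1 - Real.cos t)| ^ j ≤ C * t ^ p := by
  -- Each logarithm costs a power `η`; this choice makes `j` of them cost at most half of the room
  -- `σ + 1/2`.
  set η : ℝ := (σ + 1 / 2) / (2 * (j + 1)) with hη
  have hη0 : 0 < η := by
    have : 0 < σ + 1 / 2 := by linarith
    positivity
  set q : ℝ := σ - j * η with hq
  have hqlt : -(1 / 2) < q := by
    have : j * η ≤ (σ + 1 / 2) / 2 := by
      rw [hη, mul_div_assoc', div_le_div_iff₀ (by positivity) (by norm_num)]
      nlinarith
    linarith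
  -- The lower bound `1 - cos t ≥ 2t²/π²` bounds a power from above only when the exponent is
  -- nonpositive; the surplus `q - q'` is absorbed by `1 - cos t ≤ 2`.
  set q' : ℝ := min q 0 with hq'
  have hq'0 : q' ≤ 0 := min_le_right _ _
  have hq'q : q' ≤ q := min_le_left _ _
  have hq'lt : -(1 / 2) < q' := lt_min hqlt (by norm_num)
  set A : ℝ := (1 + 4 ^ η) / η
  have hA : 0 ≤ A := by positivity
  refine ⟨A ^ j * (2 ^ (q - q') * (2 / Real.pi ^ 2) ^ q'), 2 * q', by positivity, by linarith,
    fun t ht => ?_⟩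
  have hy := one_sub_cos_pos ht
  have hy2 := one_sub_cos_le_two t
  have hyt : 2 / Real.pi ^ 2 * t ^ 2 ≤ 1 - Real.cos t := by
    have := Real.cos_le_one_sub_mul_cos_sq (x := t) (by rw [abs_of_pos ht.1]; exact ht.2.le)
    linarith
  generalize 1 - Real.cos t = y at *
  calc y ^ σ * |Real.log y| ^ j ≤ y ^ σ * (A * y ^ (-η)) ^ j := by
        gcongr
        exact abs_log_le_rpow_neg hη0 hy hy2
    _ = A ^ j * y ^ q := by
        rw [mul_pow, ← Real.rpow_natCast (y ^ (-η)), ← Real.rpow_mul hy.le, mul_left_comm,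
          ← Real.rpow_add hy]
        congr 2
        rw [hq]; ring
    _ = A ^ j * (y ^ (q - q') * y ^ q') := by rw [← Real.rpow_add hy]; ring_nf
    _ ≤ A ^ j * (2 ^ (q - q') * ((2 / Real.pi ^ 2) ^ q' * t ^ (2 * q'))) := by
        gcongr
        have ht0 : 0 < t := ht.1
        rw [Real.rpow_mul ht0.le, ← Real.mul_rpow (by positivity) (by positivity)]
        refine Real.rpow_le_rpow_of_nonpos (by positivity) ?_ hq'0
        exact_mod_cast hyt
    _ = _ := by ring

lemma integrableOn_rpow_Ioo {p : ℝ} (hp : -1 < p) :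
    IntegrableOn (fun t : ℝ => t ^ p) (Ioo 0 Real.pi) :=
  ((intervalIntegrable_iff_integrableOn_Ioc_of_le Real.pi_pos.le).1
    (intervalIntegral.intervalIntegrable_rpow' hp)).mono_set Ioo_subset_Ioc_self

/-! ### Holomorphic dependence on the exponent -/

/-- The integrand `(1 - cos t) ^ s * log (1 - cos t) ^ j * cos (k t)`. -/
noncomputable def versineKernel (k j : ℕ) (s : ℂ) (t : ℝ) : ℂ :=
  ((1 - Real.cos t : ℝ) : ℂ) ^ s * ((Real.log (1 - Real.cos t) : ℝ) : ℂ) ^ j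
    * ((Real.cos (k * t) : ℝ) : ℂ)

/-- The integral of `(1 - cos t) ^ s * log (1 - cos t) ^ j * cos (k t)` over `(0, π)`. -/
noncomputable def versineIntegral (k j : ℕ) (s : ℂ) : ℂ :=
  ∫ t in Ioo 0 Real.pi, versineKernel k j s t

lemma norm_versineKernel_le (k j : ℕ) (s : ℂ) {t : ℝ} (ht : t ∈ Ioo 0 Real.pi) :
    ‖versineKernel k j s t‖ ≤ (1 - Real.cos t) ^ s.re * |Real.log (1 - Real.cos t)| ^ j := by
  have hy := one_sub_cos_pos ht
  rw [versineKernel, norm_mul, norm_mul, Complex.norm_cpow_eq_rpow_re_of_pos hy, norm_pow,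
    Complex.norm_real, Complex.norm_real, Real.norm_eq_abs, Real.norm_eq_abs]
  exact mul_le_of_le_one_right (by positivity) (Real.abs_cos_le_one _)

lemma continuousOn_versineKernel (k j : ℕ) (s : ℂ) :
    ContinuousOn (versineKernel k j s) (Ioo 0 Real.pi) := by
  have h1 : ContinuousOn (fun t : ℝ => 1 - Real.cos t) (Ioo 0 Real.pi) := by fun_prop
  refine (ContinuousOn.mul ?_ (ContinuousOn.pow ?_ j)).mul (by fun_prop)
  · refine (Complex.continuous_ofReal.comp_continuousOn h1).cpow_const fun t ht => ?_
    exact Complex.ofReal_mem_slitPlane.2 (one_sub_cos_pos ht)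
  · exact Complex.continuous_ofReal.comp_continuousOn
      (h1.log fun t ht => (one_sub_cos_pos ht).ne')

lemma aestronglyMeasurable_versineKernel (k j : ℕ) (s : ℂ) :
    AEStronglyMeasurable (versineKernel k j s) (volume.restrict (Ioo 0 Real.pi)) :=
  (continuousOn_versineKernel k j s).aestronglyMeasurable measurableSet_Ioo

lemma integrableOn_versineKernel (k j : ℕ) {s : ℂ} (hs : -(1 / 2) < s.re) :
    IntegrableOn (versineKernel k j s) (Ioo 0 Real.pi) := by
  obtain ⟨C, p, -, hp, h⟩ := exists_rpow_mul_log_pow_le hs j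
  refine Integrable.mono' ((integrableOn_rpow_Ioo hp).const_mul C)
    (aestronglyMeasurable_versineKernel k j s) ?_
  filter_upwards [ae_restrict_mem measurableSet_Ioo] with t ht
  exact (norm_versineKernel_le k j s ht).trans (h t ht)

lemma hasDerivAt_versineKernel (k j : ℕ) (s : ℂ) {t : ℝ} (ht : t ∈ Ioo 0 Real.pi) :
    HasDerivAt (fun s => versineKernel k j s t) (versineKernel k (j + 1) s t) s := by
  have hy := one_sub_cos_pos ht
  unfold versineKernel
  have h0 : ((1 - Real.cos t : ℝ) : ℂ) ≠ 0 := Complex.ofReal_ne_zero.2 hy.ne'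
  have h := ((hasDerivAt_id s).const_cpow (c := ((1 - Real.cos t : ℝ) : ℂ)) (Or.inl h0))
  have h2 := (h.mul_const (((Real.log (1 - Real.cos t) : ℝ) : ℂ) ^ j)).mul_const
    ((Real.cos (k * t) : ℝ) : ℂ)
  refine h2.congr_deriv ?_
  rw [← Complex.ofReal_log hy.le, pow_succ]
  simp only [id]
  ring

lemma hasDerivAt_versineIntegral (k j : ℕ) {s : ℂ} (hs : -(1 / 2) < s.re) :
    HasDerivAt (versineIntegral k j) (versineIntegral k (j + 1) s) s := by
  obtain ⟨σ, hσ, hσs⟩ := exists_between hs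
  obtain ⟨C, p, hC, hp, h⟩ := exists_rpow_mul_log_pow_le hσ (j + 1)
  -- The left edge of the strip controls the singularity at `t = 0`, the right edge the values `1 -
  -- cos t > 1`.
  have hU : {z : ℂ | σ < z.re ∧ z.re < s.re + 1} ∈ 𝓝 s := by
    refine ((isOpen_lt continuous_const Complex.continuous_re).inter
      (isOpen_lt Complex.continuous_re continuous_const)).mem_nhds ⟨hσs, ?_⟩
    show s.re < s.re + 1
    linarith
  refine (hasDerivAt_integral_of_dominated_loc_of_deriv_le (μ := volume.restrict (Ioo 0 Real.pi))
    (F := fun s t => versineKernel k j s t) (F' := fun s t => versineKernel k (j + 1) s t)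
    (bound := fun t => 2 ^ (s.re + 1 - σ) * (C * t ^ p)) hU ?_ ?_ ?_ ?_ ?_ ?_).2
  · exact Eventually.of_forall fun z => aestronglyMeasurable_versineKernel k j z
  · exact integrableOn_versineKernel k j hs
  · exact aestronglyMeasurable_versineKernel k (j + 1) s
  · filter_upwards [ae_restrict_mem measurableSet_Ioo] with t ht z hz
    have hy := one_sub_cos_pos ht
    refine (norm_versineKernel_le k (j + 1) z ht).trans ?_
    calc (1 - Real.cos t) ^ z.re * |Real.log (1 - Real.cos t)| ^ (j + 1)
        = (1 - Real.cos t) ^ (z.re - σ) *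
          ((1 - Real.cos t) ^ σ * |Real.log (1 - Real.cos t)| ^ (j + 1)) := by
          rw [← mul_assoc, ← Real.rpow_add hy]; ring_nf
      _ ≤ 2 ^ (s.re + 1 - σ) * (C * t ^ p) := by
          refine mul_le_mul ?_ (h t ht) (by positivity) (by positivity)
          calc (1 - Real.cos t) ^ (z.re - σ) ≤ 2 ^ (z.re - σ) :=
                Real.rpow_le_rpow hy.le (one_sub_cos_le_two t) (by linarith [hz.1])
            _ ≤ 2 ^ (s.re + 1 - σ) :=
                Real.rpow_le_rpow_of_exponent_le (by norm_num) (by linarith [hz.2])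
  · exact ((integrableOn_rpow_Ioo hp).const_mul C).const_mul _
  · filter_upwards [ae_restrict_mem measurableSet_Ioo] with t ht z _
    exact hasDerivAt_versineKernel k j z ht

lemma isOpen_halfPlane : IsOpen {z : ℂ | -(1 / 2) < z.re} :=
  isOpen_lt continuous_const Complex.continuous_re

lemma differentiableOn_versineIntegral (k j : ℕ) :
    DifferentiableOn ℂ (versineIntegral k j) {z : ℂ | -(1 / 2) < z.re} :=
  fun _ hz => (hasDerivAt_versineIntegral k j hz).differentiableAt.differentiableWithinAt

lemma iteratedDeriv_versineIntegral (k j : ℕ) {s : ℂ} (hs : -(1 / 2) < s.re) :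
    iteratedDeriv j (versineIntegral k 0) s = versineIntegral k j s := by
  induction j generalizing s with
  | zero => simp
  | succ j ih =>
    rw [iteratedDeriv_succ]
    have : iteratedDeriv j (versineIntegral k 0) =ᶠ[𝓝 s] versineIntegral k j := by
      filter_upwards [isOpen_halfPlane.mem_nhds hs] with z hz using ih hz
    rw [this.deriv_eq, (hasDerivAt_versineIntegral k j hs).deriv]

/-! ### Recurrence in `k` -/

/-- Cauchy-Schwarz: the difference is the scalar product of the unit vector `(sin a, cos a)` with a
chord of length `√(2(1 - cos t))`. The half power gained makes a boundary term vanish exactly when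
`Re s > -1/2`. -/
lemma abs_sin_add_sub_sin_le (a t : ℝ) :
    |Real.sin (a + t) - Real.sin a| ≤ √2 * (1 - Real.cos t) ^ (1 / 2 : ℝ) := by
  rw [← Real.sqrt_eq_rpow, ← Real.sqrt_mul (by norm_num)]
  refine Real.abs_le_sqrt ?_
  rw [Real.sin_add]
  have h1 := Real.sin_sq_add_cos_sq a
  have h2 := Real.sin_sq_add_cos_sq t
  generalize Real.sin a = S at *
  generalize Real.cos a = C at *
  generalize Real.sin t = s at *
  generalize Real.cos t = c at *
  have h3 : 2 * (1 - c) = (S ^ 2 + C ^ 2) * ((c - 1) ^ 2 + s ^ 2) := by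
    rw [h1]; linear_combination -h2
  rw [h3]
  nlinarith [sq_nonneg (S * s - C * (c - 1))]

lemma hasDerivAt_cpow_one_sub_cos (s : ℂ) {t : ℝ} (ht : 0 < 1 - Real.cos t) :
    HasDerivAt (fun t : ℝ => ((1 - Real.cos t : ℝ) : ℂ) ^ s)
      (s * ((1 - Real.cos t : ℝ) : ℂ) ^ (s - 1) * (Real.sin t : ℝ)) t := by
  have h1 : HasDerivAt (fun t : ℝ => 1 - Real.cos t) (Real.sin t) t := by
    simpa using (Real.hasDerivAt_cos t).const_sub 1
  have h2 := (hasDerivAt_id ((1 - Real.cos t : ℝ) : ℂ)).cpow_const (c := s)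
    (Complex.ofReal_mem_slitPlane.2 ht)
  have h3 := HasDerivAt.comp t h2 h1.ofReal_comp
  rw [mul_one] at h3
  exact h3

/-- The function `(1 - cos t)^s (sin((k+1)t) - sin(kt))` vanishes at both endpoints, and its
derivative is the difference of the two integrands. -/
lemma versineIntegral_succ (k : ℕ) {s : ℂ} (hs : -(1 / 2) < s.re) :
    (k + 1 + s) * versineIntegral (k + 1) 0 s = (k - s) * versineIntegral k 0 s := by
  set G : ℝ → ℂ := fun t => ((1 - Real.cos t : ℝ) : ℂ) ^ s *
    ((Real.sin (k * t + t) - Real.sin (k * t) : ℝ) : ℂ) with hG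
  set G' : ℝ → ℂ := fun t => (k + 1 + s) * versineKernel (k + 1) 0 s t -
    (k - s) * versineKernel k 0 s t with hG'
  have hderiv : ∀ t ∈ Ioo 0 Real.pi, HasDerivAt G (G' t) t := by
    intro t ht
    have hy := one_sub_cos_pos ht
    have hr : HasDerivAt (fun t : ℝ => Real.sin (k * t + t) - Real.sin (k * t))
        (Real.cos (k * t + t) * (k + 1) - Real.cos (k * t) * k) t := by
      have h1 : HasDerivAt (fun t : ℝ => k * t) (k : ℝ) t := by
        simpa using (hasDerivAt_id t).const_mul (k : ℝ)
      exact (h1.add (hasDerivAt_id t)).sin.sub h1.sin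
    refine ((hasDerivAt_cpow_one_sub_cos s hy).mul hr.ofReal_comp).congr_deriv ?_
    have h0 : ((1 - Real.cos t : ℝ) : ℂ) ≠ 0 := Complex.ofReal_ne_zero.2 hy.ne'
    -- This identity trades the factor `sin t` for `1 - cos t`, lifting the exponent `s - 1` back to
    -- `s`.
    have htrig : ((Real.sin t : ℝ) : ℂ) * ((Real.sin (k * t + t) - Real.sin (k * t) : ℝ) : ℂ) =
        ((1 - Real.cos t : ℝ) : ℂ) *
          ((Real.cos (k * t + t) + Real.cos (k * t) : ℝ) : ℂ) := by
      rw [← Complex.ofReal_mul, ← Complex.ofReal_mul]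
      congr 1
      rw [Real.sin_add, Real.cos_add]
      linear_combination Real.cos (k * t) * Real.sin_sq_add_cos_sq t
    have hpow : ((1 - Real.cos t : ℝ) : ℂ) ^ (s - 1) * ((1 - Real.cos t : ℝ) : ℂ) =
        ((1 - Real.cos t : ℝ) : ℂ) ^ s := by
      rw [Complex.cpow_sub _ _ h0, Complex.cpow_one, div_mul_cancel₀ _ h0]
    have hk : ((k + 1 : ℕ) : ℝ) * t = k * t + t := by push_cast; ring
    simp only [hG', versineKernel, pow_zero, mul_one, hk]
    generalize ((1 - Real.cos t : ℝ) : ℂ) ^ (s - 1) = P at *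
    rw [mul_assoc (s * P), htrig, ← hpow]
    push_cast
    ring
  have hint : IntervalIntegrable G' volume 0 Real.pi := by
    rw [intervalIntegrable_iff_integrableOn_Ioo_of_le Real.pi_pos.le]
    exact ((integrableOn_versineKernel (k + 1) 0 hs).const_mul _).sub
      ((integrableOn_versineKernel k 0 hs).const_mul _)
  have hzero : Tendsto G (𝓝[>] 0) (𝓝 0) := by
    have hlim : Tendsto (fun t : ℝ => √2 * (1 - Real.cos t) ^ (s.re + 1 / 2)) (𝓝[>] 0)
        (𝓝 0) := by
      have hc : Continuous (fun t : ℝ => √2 * (1 - Real.cos t) ^ (s.re + 1 / 2)) :=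
        continuous_const.mul ((continuous_const.sub Real.continuous_cos).rpow_const
          fun _ => Or.inr (by linarith))
      have := hc.tendsto 0
      simp only [Real.cos_zero, sub_self] at this
      rw [Real.zero_rpow (by linarith), mul_zero] at this
      exact this.mono_left nhdsWithin_le_nhds
    refine squeeze_zero_norm' ?_ hlim
    filter_upwards [Ioo_mem_nhdsGT Real.pi_pos] with t ht
    have hy := one_sub_cos_pos ht
    rw [hG, norm_mul, Complex.norm_cpow_eq_rpow_re_of_pos hy, Complex.norm_real, Real.norm_eq_abs]
    calc _ ≤ (1 - Real.cos t) ^ s.re * (√2 * (1 - Real.cos t) ^ (1 / 2 : ℝ)) := by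
          gcongr
          exact abs_sin_add_sub_sin_le _ _
      _ = _ := by rw [Real.rpow_add hy]; ring
  have hpi : Tendsto G (𝓝[<] Real.pi) (𝓝 0) := by
    have hc : ContinuousAt G Real.pi := by
      refine (hasDerivAt_cpow_one_sub_cos s (by simp)).continuousAt.mul ?_
      fun_prop
    have h0 : G Real.pi = 0 := by
      have : (k : ℝ) * Real.pi + Real.pi = ((k + 1 : ℕ) : ℝ) * Real.pi := by push_cast; ring
      simp only [hG, this, Real.sin_nat_mul_pi, sub_self, Complex.ofReal_zero, mul_zero]
    have := hc.tendsto
    rw [h0] at this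
    exact this.mono_left nhdsWithin_le_nhds
  have key := intervalIntegral.integral_eq_sub_of_hasDerivAt_of_tendsto Real.pi_pos hderiv hint
    hzero hpi
  rw [intervalIntegral.integral_of_le Real.pi_pos.le, integral_Ioc_eq_integral_Ioo,
    integral_sub ((integrableOn_versineKernel (k + 1) 0 hs).const_mul _)
      ((integrableOn_versineKernel k 0 hs).const_mul _), integral_const_mul, integral_const_mul,
    sub_zero, sub_eq_zero] at key
  exact key

/-! ### Initial value and product formula -/

lemma image_one_sub_cos_div_two :
    (fun t : ℝ => (1 - Real.cos t) / 2) '' Ioo 0 Real.pi = Ioo 0 1 := by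
  ext y
  simp only [mem_image, mem_Ioo]
  constructor
  · rintro ⟨t, ht, rfl⟩
    have h1 := one_sub_cos_pos ht
    have h2 := Real.cos_lt_cos_of_nonneg_of_le_pi ht.1.le le_rfl ht.2
    rw [Real.cos_pi] at h2
    constructor <;> linarith
  · rintro ⟨h0, h1⟩
    refine ⟨Real.arccos (1 - 2 * y), ⟨Real.arccos_pos.2 (by linarith), ?_⟩, ?_⟩
    · rw [← Real.arccos_neg_one]
      exact Real.strictAntiOn_arccos ⟨le_rfl, by norm_num⟩ ⟨by linarith, by linarith⟩
        (by linarith)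
    · rw [Real.cos_arccos (by linarith) (by linarith)]
      ring

lemma injOn_cos_Ioo : InjOn Real.cos (Ioo 0 Real.pi) :=
  Real.injOn_cos.mono Ioo_subset_Icc_self

/-- With `u = (1 - cos t)/2` one has `du = √(u(1-u)) dt`, which gives the Beta integral with
parameters `s + 1/2` and `1/2`. -/
lemma versineIntegral_zero_zero {s : ℂ} (hs : -(1 / 2) < s.re) :
    versineIntegral 0 0 s =
      2 ^ s * (Complex.Gamma (s + 1 / 2) * √Real.pi / Complex.Gamma (s + 1)) := by
  have hre : 0 < (s + 1 / 2).re := by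
    simp only [Complex.add_re]; norm_num; linarith
  have hre1 : 0 < (s + 1).re := by
    simp only [Complex.add_re, Complex.one_re]; linarith
  have hbeta := Complex.Gamma_mul_Gamma_eq_betaIntegral hre
    (show 0 < (1 / 2 : ℂ).re by norm_num)
  rw [show s + 1 / 2 + 1 / 2 = s + 1 by ring, Complex.Gamma_one_half_eq] at hbeta
  have hpi : (√Real.pi : ℂ) = (Real.pi : ℂ) ^ (1 / 2 : ℂ) := by
    rw [Real.sqrt_eq_rpow, Complex.ofReal_cpow Real.pi_pos.le]; norm_num
  rw [hpi, hbeta, mul_div_cancel_left₀ _ (Complex.Gamma_ne_zero_of_re_pos hre1),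
    Complex.betaIntegral, intervalIntegral.integral_of_le zero_le_one,
    integral_Ioc_eq_integral_Ioo, ← image_one_sub_cos_div_two,
    integral_image_eq_integral_abs_deriv_smul (f' := fun t => Real.sin t / 2) measurableSet_Ioo,
    versineIntegral, ← integral_const_mul]
  · refine setIntegral_congr_fun measurableSet_Ioo fun t ht => ?_
    have hy := one_sub_cos_pos ht
    have hsin := Real.sin_pos_of_pos_of_lt_pi ht.1 ht.2
    have hz : 0 < 1 - (1 - Real.cos t) / 2 := by
      have h2 := Real.cos_lt_cos_of_nonneg_of_le_pi ht.1.le le_rfl ht.2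
      rw [Real.cos_pi] at h2
      linarith
    have hu : 0 < (1 - Real.cos t) / 2 := by positivity
    have hsq : Real.sin t / 2 = ((1 - Real.cos t) / 2) ^ (1 / 2 : ℝ) *
        (1 - (1 - Real.cos t) / 2) ^ (1 / 2 : ℝ) := by
      rw [← Real.mul_rpow hu.le hz.le, ← Real.sqrt_eq_rpow]
      symm
      rw [Real.sqrt_eq_iff_mul_self_eq (by positivity) (by positivity)]
      linear_combination (-1 / 4) * Real.sin_sq_add_cos_sq t
    have hy2 : ((1 - Real.cos t : ℝ) : ℂ) ^ s = 2 ^ s * (((1 - Real.cos t) / 2 : ℝ) : ℂ) ^ s := by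
      have := Complex.mul_cpow_ofReal_nonneg (zero_le_two) hu.le s
      rw [← Complex.ofReal_mul, mul_div_cancel₀ _ two_ne_zero] at this
      simpa using this
    have hfold : (1 : ℂ) - (((1 - Real.cos t) / 2 : ℝ) : ℂ) =
        ((1 - (1 - Real.cos t) / 2 : ℝ) : ℂ) := by push_cast; ring
    rw [versineKernel, hy2, abs_of_pos (by positivity), hsq, Complex.real_smul, hfold]
    generalize 1 - (1 - Real.cos t) / 2 = v at *
    generalize (1 - Real.cos t) / 2 = u at *
    have hu0 : (u : ℂ) ≠ 0 := Complex.ofReal_ne_zero.2 hu.ne'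
    have hv0 : (v : ℂ) ≠ 0 := Complex.ofReal_ne_zero.2 hz.ne'
    rw [Complex.ofReal_mul, Complex.ofReal_cpow hu.le, Complex.ofReal_cpow hz.le]
    have e1 : (u : ℂ) ^ ((1 / 2 : ℝ) : ℂ) * (u : ℂ) ^ (s + 1 / 2 - 1) = (u : ℂ) ^ s := by
      rw [← Complex.cpow_add _ _ hu0]; congr 1; push_cast; ring
    have e2 : (v : ℂ) ^ ((1 / 2 : ℝ) : ℂ) * (v : ℂ) ^ ((1 / 2 : ℂ) - 1) = 1 := by
      rw [← Complex.cpow_add _ _ hv0]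
      convert Complex.cpow_zero _ using 2
      push_cast; ring
    rw [← e1]
    simp only [Nat.cast_zero, zero_mul, Real.cos_zero, pow_zero, Complex.ofReal_one, mul_one]
    linear_combination (-(2 ^ s * (u : ℂ) ^ ((1 / 2 : ℝ) : ℂ) * (u : ℂ) ^ (s + 1 / 2 - 1))) * e2
  · intro t _
    simpa using (((Real.hasDerivAt_cos t).const_sub 1).div_const 2).hasDerivWithinAt
  · intro x hx y hy h
    refine injOn_cos_Ioo hx hy ?_
    simp only at h
    linarith

lemma add_natCast_ne_zero {s : ℂ} (hs : -(1 / 2) < s.re) (k : ℕ) : (k : ℂ) + 1 + s ≠ 0 := by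
  intro h
  have := congrArg Complex.re h
  simp at this
  have hk : (0 : ℝ) ≤ k := k.cast_nonneg
  linarith

lemma versineIntegral_eq_prod (k : ℕ) {s : ℂ} (hs : -(1 / 2) < s.re) :
    versineIntegral k 0 s =
      versineIntegral 0 0 s * ∏ j ∈ Finset.range k, ((j : ℂ) - s) / (j + 1 + s) := by
  induction k with
  | zero => simp
  | succ k ih =>
    have h := versineIntegral_succ k hs
    have h0 := add_natCast_ne_zero hs k
    rw [Finset.prod_range_succ, ← mul_assoc, ← ih]
    field_simp
    linear_combination h

/-! ### Convergence of the scaled product -/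

/-- If consecutive terms of a convergent sequence differ relatively by at most `C / k ^ 2`,
then the sequence converges at rate `1 / k`. -/
lemma norm_sub_limit_le_of_relative_step {u : ℕ → ℂ} {l : ℂ} {C : ℝ} (hC : 0 ≤ C) {m : ℕ}
    (hm : 1 ≤ m) (hu : ∀ k, m ≤ k → ‖u (k + 1) - u k‖ ≤ C / (k : ℝ) ^ 2 * ‖u k‖)
    (hl : Tendsto u atTop (𝓝 l)) {k : ℕ} (hk : m ≤ k) :
    ‖u k - l‖ ≤ 2 * C * (‖u m‖ * Real.exp (2 * C)) / k := by
  -- Replacing `C / k²` by a telescoping majorant bounds both the growth of `u` and its distance to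
  -- the limit. The resulting constant involves `u` only through `‖u m‖`, so it can be made uniform
  -- in a parameter.
  have hstep : ∀ k : ℕ, m ≤ k → C / (k : ℝ) ^ 2 ≤ 2 * C * (1 / (k : ℝ) - 1 / ((k + 1 : ℕ) : ℝ)) := by
    intro k hk
    have hk1 : (1 : ℝ) ≤ k := by exact_mod_cast hm.trans hk
    have : 1 / (k : ℝ) - 1 / ((k + 1 : ℕ) : ℝ) = 1 / (k * (k + 1)) := by
      push_cast; field_simp; ring
    rw [this, mul_one_div, div_le_div_iff₀ (by positivity) (by positivity)]
    nlinarith [mul_nonneg hC (by linarith : (0 : ℝ) ≤ k),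
      mul_nonneg (mul_nonneg hC (by linarith : (0 : ℝ) ≤ k)) (by linarith : (0 : ℝ) ≤ k - 1)]
  have hgrow : ∀ k : ℕ, m ≤ k →
      ‖u k‖ ≤ ‖u m‖ * Real.exp (2 * C * (1 / (m : ℝ) - 1 / (k : ℝ))) := by
    intro k hk
    induction k, hk using Nat.le_induction with
    | base => simp
    | succ k hk ih =>
      have h1 : ‖u (k + 1)‖ ≤ (C / (k : ℝ) ^ 2 + 1) * ‖u k‖ := by
        have := norm_le_norm_sub_add (u (k + 1)) (u k)
        linarith [hu k hk]
      calc ‖u (k + 1)‖ ≤ (C / (k : ℝ) ^ 2 + 1) * ‖u k‖ := h1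
        _ ≤ Real.exp (2 * C * (1 / (k : ℝ) - 1 / ((k + 1 : ℕ) : ℝ))) *
            (‖u m‖ * Real.exp (2 * C * (1 / (m : ℝ) - 1 / (k : ℝ)))) := by
            gcongr
            exact (Real.add_one_le_exp _).trans (Real.exp_le_exp.2 (hstep k hk))
        _ = _ := by
            rw [mul_left_comm, ← Real.exp_add]; congr 2; ring
  set B := ‖u m‖ * Real.exp (2 * C) with hB
  have hbound : ∀ k : ℕ, m ≤ k → ‖u k‖ ≤ B := by
    intro k hk
    refine (hgrow k hk).trans ?_
    have hm1 : (1 : ℝ) / m ≤ 1 := by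
      rw [div_le_one (by exact_mod_cast hm)]; exact_mod_cast hm
    have hk0 : (0 : ℝ) ≤ 1 / (k : ℝ) := by positivity
    refine mul_le_mul_of_nonneg_left (Real.exp_le_exp.2 ?_) (norm_nonneg _)
    nlinarith
  have hdiff : ∀ n : ℕ, k ≤ n → ‖u k - u n‖ ≤ 2 * C * B * (1 / (k : ℝ) - 1 / (n : ℝ)) := by
    intro n hn
    induction n, hn using Nat.le_induction with
    | base => simp
    | succ n hn ih =>
      have hmn := hk.trans hn
      have h1 : ‖u (n + 1) - u n‖ ≤ 2 * C * (1 / (n : ℝ) - 1 / ((n + 1 : ℕ) : ℝ)) * B := by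
        refine (hu n hmn).trans (mul_le_mul (hstep n hmn) (hbound n hmn) (norm_nonneg _) ?_)
        exact (by positivity : 0 ≤ C / (n : ℝ) ^ 2).trans (hstep n hmn)
      have h2 : ‖u k - u (n + 1)‖ ≤ ‖u k - u n‖ + ‖u (n + 1) - u n‖ := by
        rw [norm_sub_rev (u (n + 1))]
        exact norm_sub_le_norm_sub_add_norm_sub _ _ _
      linarith
  refine le_of_tendsto (hl.const_sub (u k)).norm ?_
  filter_upwards [eventually_ge_atTop k] with n hn
  refine (hdiff n hn).trans ?_
  rw [mul_sub, mul_one_div]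
  have : 0 ≤ 2 * C * B * (1 / (n : ℝ)) := by positivity
  linarith

/-- The product `∏_{j < k} (j - s) / (j + 1 + s)` scaled by `k ^ (2 s + 1)`. -/
noncomputable def scaledProd (k : ℕ) (s : ℂ) : ℂ :=
  (k : ℂ) ^ (2 * s + 1) * ∏ j ∈ Finset.range k, ((j : ℂ) - s) / (j + 1 + s)

lemma natCast_le_norm_add {s : ℂ} (hs : -(1 / 2) < s.re) (k : ℕ) :
    (k : ℝ) ≤ ‖(k : ℂ) + 1 + s‖ := by
  refine le_trans ?_ (Complex.re_le_norm _)
  simp only [Complex.add_re, Complex.natCast_re, Complex.one_re]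
  linarith

lemma norm_one_add_cpow_sub_le {a : ℂ} {A x : ℝ} (ha : ‖a‖ ≤ A) (hx : 0 ≤ x) (hAx : A * x ≤ 1) :
    ‖((1 + x : ℝ) : ℂ) ^ a - 1 - a * x‖ ≤ (A ^ 2 + A) * x ^ 2 := by
  have hA : 0 ≤ A := (norm_nonneg a).trans ha
  have hx1 : 0 < 1 + x := by linarith
  set L := Real.log (1 + x) with hL
  have hL0 : 0 ≤ L := Real.log_nonneg (by linarith)
  have hLx : L ≤ x := by
    have := Real.log_le_sub_one_of_pos hx1
    linarith
  have hLx2 : x - L ≤ x ^ 2 := by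
    have h1 := Real.one_sub_inv_le_log_of_pos hx1
    have h2 : x - x ^ 2 ≤ 1 - (1 + x)⁻¹ := by
      have : 1 - (1 + x)⁻¹ = x / (1 + x) := by field_simp; ring
      rw [this, le_div_iff₀ hx1]
      nlinarith [pow_nonneg hx 3]
    linarith
  have haL : ‖a * L‖ ≤ A * x := by
    rw [norm_mul, Complex.norm_real, Real.norm_of_nonneg hL0]
    exact mul_le_mul ha hLx hL0 hA
  have h1 : ((1 + x : ℝ) : ℂ) ^ a = Complex.exp (a * L) := by
    rw [Complex.cpow_def_of_ne_zero (Complex.ofReal_ne_zero.2 hx1.ne'), ← Complex.ofReal_log hx1.le,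
      mul_comm]
  have h2 : ((1 + x : ℝ) : ℂ) ^ a - 1 - a * x =
      (Complex.exp (a * L) - 1 - a * L) + a * ((L - x : ℝ) : ℂ) := by
    rw [h1]; push_cast; ring
  rw [h2]
  refine (norm_add_le _ _).trans ?_
  have h3 := Complex.norm_exp_sub_one_sub_id_le (haL.trans hAx)
  have h4 : ‖a * L‖ ^ 2 ≤ (A * x) ^ 2 := by gcongr
  have h5 : ‖a * ((L - x : ℝ) : ℂ)‖ ≤ A * x ^ 2 := by
    rw [norm_mul, Complex.norm_real, Real.norm_eq_abs, abs_sub_comm, abs_of_nonneg (by linarith)]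
    exact mul_le_mul ha hLx2 (by linarith) hA
  nlinarith

/-- With `a = 2s + 1`, `(1 + a/k)(k - s) = (k + 1 + s) - as/k`: this exponent cancels the `1/k` term
of the ratio of consecutive terms, leaving a relative step of order `1/k²`. -/
lemma norm_scaledProd_succ_sub_le {R : ℝ} {s : ℂ} (hs : -(1 / 2) < s.re) (hR : ‖s‖ ≤ R) {k : ℕ}
    (hk1 : 1 ≤ k) (hk : 2 * R + 1 ≤ k) :
    ‖scaledProd (k + 1) s - scaledProd k s‖ ≤
      ((2 * R + 1) * R + 2 * ((2 * R + 1) ^ 2 + (2 * R + 1))) / (k : ℝ) ^ 2 * ‖scaledProd k s‖ := by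
  have hR0 : 0 ≤ R := (norm_nonneg s).trans hR
  have hkpos : (0 : ℝ) < k := by exact_mod_cast hk1
  have hkC : (k : ℂ) ≠ 0 := by exact_mod_cast hkpos.ne'
  have hd := add_natCast_ne_zero hs k
  set A := 2 * R + 1 with hA
  set a : ℂ := 2 * s + 1 with ha
  have haA : ‖a‖ ≤ A := by
    refine (norm_add_le _ _).trans ?_
    simp only [norm_mul, Complex.norm_ofNat, norm_one]
    linarith
  set x : ℝ := 1 / k with hx
  set e : ℂ := ((1 + x : ℝ) : ℂ) ^ a - 1 - a * x with he
  have hxk : (x : ℂ) * k = 1 := by rw [hx]; push_cast; field_simp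
  have hele : ‖e‖ ≤ (A ^ 2 + A) * x ^ 2 :=
    norm_one_add_cpow_sub_le haA (by positivity) (by rw [hx, mul_one_div, div_le_one hkpos]; exact hk)
  have hpow : ((k + 1 : ℕ) : ℂ) ^ a = (k : ℂ) ^ a * ((1 + x : ℝ) : ℂ) ^ a := by
    have h1 : ((k + 1 : ℕ) : ℂ) = ((k : ℝ) : ℂ) * ((1 + x : ℝ) : ℂ) := by
      rw [← Complex.ofReal_mul, mul_add, hx]
      push_cast
      field_simp
    rw [h1, Complex.mul_cpow_ofReal_nonneg hkpos.le (by positivity)]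
    simp
  have hratio : scaledProd (k + 1) s - scaledProd k s =
      (e * (k - s) - a * s * x) / (k + 1 + s) * scaledProd k s := by
    rw [scaledProd, scaledProd, Finset.prod_range_succ, ← ha, hpow,
      show ((1 + x : ℝ) : ℂ) ^ a = e + 1 + a * x by rw [he]; ring]
    field_simp
    rw [ha]
    linear_combination ((k : ℂ) ^ (2 * s + 1) * (∏ j ∈ Finset.range k, ((j : ℂ) - s) / (j + 1 + s)))
      * (2 * s + 1) * hxk
  rw [hratio, norm_mul, norm_div]
  refine mul_le_mul_of_nonneg_right ?_ (norm_nonneg _)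
  rw [div_le_div_iff₀ (hkpos.trans_le (natCast_le_norm_add hs k)) (by positivity)]
  have hnum : ‖e * (k - s) - a * s * x‖ ≤ (A * R + 2 * (A ^ 2 + A)) * x := by
    have h1 : ‖(k : ℂ) - s‖ ≤ 2 * k := by
      refine (norm_sub_le _ _).trans ?_
      rw [Complex.norm_natCast]
      linarith
    calc ‖e * (k - s) - a * s * x‖ ≤ ‖e‖ * ‖(k : ℂ) - s‖ + ‖a‖ * ‖s‖ * ‖(x : ℂ)‖ := by
          refine (norm_sub_le _ _).trans ?_
          simp only [norm_mul]; rfl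
      _ ≤ (A ^ 2 + A) * x ^ 2 * (2 * k) + A * R * x := by
          rw [Complex.norm_real, Real.norm_of_nonneg (by positivity : 0 ≤ x)]
          gcongr
      _ = (A * R + 2 * (A ^ 2 + A)) * x := by
          rw [hx]; field_simp; ring
  calc ‖e * (k - s) - a * s * x‖ * (k : ℝ) ^ 2
      ≤ (A * R + 2 * (A ^ 2 + A)) * x * (k : ℝ) ^ 2 := by gcongr
    _ = (A * R + 2 * (A ^ 2 + A)) * k := by rw [hx]; field_simp
    _ ≤ _ := by
        gcongr
        exact natCast_le_norm_add hs k

/-- Off the natural numbers the product is a quotient of Euler's approximants to `Γ(s+1)` and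
`Γ(-s)`, and reflection rewrites `1/Γ(-s)`. At natural `s`, where `Γ(-s)` has a pole, the product is
eventually zero and so is the sine. -/
lemma tendsto_scaledProd {s : ℂ} (hs : -(1 / 2) < s.re) :
    Tendsto (fun k => scaledProd k s) atTop
      (𝓝 (-(Complex.sin (Real.pi * s) * Complex.Gamma (s + 1) ^ 2 / Real.pi))) := by
  have hpi : (Real.pi : ℂ) ≠ 0 := Complex.ofReal_ne_zero.2 Real.pi_ne_zero
  by_cases hn : ∃ m : ℕ, s = m
  · obtain ⟨m, rfl⟩ := hn
    rw [mul_comm (Real.pi : ℂ), Complex.sin_nat_mul_pi, zero_mul, zero_div, neg_zero]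
    refine tendsto_const_nhds.congr' ?_
    filter_upwards [eventually_gt_atTop m] with k hk
    rw [scaledProd, Finset.prod_eq_zero (Finset.mem_range.2 hk) (by simp), mul_zero]
  · push Not at hn
    have hG : Complex.Gamma (-s) ≠ 0 :=
      Complex.Gamma_ne_zero fun m h => hn m (neg_injective h)
    have h1 := (Complex.GammaSeq_tendsto_Gamma (s + 1)).div
      (Complex.GammaSeq_tendsto_Gamma (-s)) hG
    have hinv := tendsto_inv_atTop_nhds_zero_nat (𝕜 := ℂ)
    -- `GammaSeq` multiplies over `n + 1` factors, the scaled product over `n`; the leftover `(n + 1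
    -- + s)/(n - s)` tends to one.
    have h2 : Tendsto (fun n : ℕ => (1 + (s + 1) * (n : ℂ)⁻¹) / (1 - s * (n : ℂ)⁻¹)) atTop
        (𝓝 ((1 + (s + 1) * 0) / (1 - s * 0))) :=
      ((hinv.const_mul _).const_add 1).div ((hinv.const_mul _).const_sub 1) (by simp)
    have h3 := h1.mul h2
    have hrefl := Complex.Gamma_mul_Gamma_one_sub (-s)
    rw [show 1 - -s = s + 1 by ring, mul_neg, Complex.sin_neg] at hrefl
    have hsin : Complex.sin (Real.pi * s) ≠ 0 := by
      intro h
      rw [h, neg_zero, div_zero] at hrefl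
      exact mul_ne_zero hG (Complex.Gamma_ne_zero_of_re_pos
        (by simp only [Complex.add_re, Complex.one_re]; linarith)) hrefl
    have hval : Complex.Gamma (s + 1) / Complex.Gamma (-s) * ((1 + (s + 1) * 0) / (1 - s * 0)) =
        -(Complex.sin (Real.pi * s) * Complex.Gamma (s + 1) ^ 2 / Real.pi) := by
      rw [div_neg, eq_comm, neg_eq_iff_eq_neg, div_eq_iff hsin] at hrefl
      simp only [mul_zero, add_zero, sub_zero, div_one, mul_one]
      generalize Complex.sin (Real.pi * s) = S at *
      rw [div_eq_iff hG]
      field_simp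
      linear_combination Complex.Gamma (s + 1) * hrefl
    rw [hval] at h3
    refine h3.congr' ?_
    filter_upwards [eventually_ge_atTop 1] with n hn1
    have hn0 : (n : ℂ) ≠ 0 := by exact_mod_cast (by omega : n ≠ 0)
    have hns : (n : ℂ) - s ≠ 0 := sub_ne_zero.2 fun h => hn n h.symm
    have hd := add_natCast_ne_zero hs n
    have hfac : ((n.factorial : ℕ) : ℂ) ≠ 0 := by exact_mod_cast n.factorial_ne_zero
    have e1 : (n : ℂ) ^ (s + 1) = (n : ℂ) ^ (2 * s + 1) * (n : ℂ) ^ (-s) := by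
      rw [← Complex.cpow_add _ _ hn0]; congr 1; ring
    have hc : (n : ℂ) ^ (-s) ≠ 0 := by simp [Complex.cpow_eq_zero_iff, hn0]
    have hP : ∏ j ∈ Finset.range n, (-s + j) ≠ 0 :=
      Finset.prod_ne_zero_iff.2 fun j _ h => hn j (by linear_combination -h)
    have hQ : ∏ j ∈ Finset.range n, (s + 1 + j) ≠ 0 :=
      Finset.prod_ne_zero_iff.2 fun j _ h => add_natCast_ne_zero hs j (by linear_combination h)
    have hprod : ∏ j ∈ Finset.range n, ((j : ℂ) - s) / (j + 1 + s) =
        (∏ j ∈ Finset.range n, (-s + j)) / ∏ j ∈ Finset.range n, (s + 1 + (j : ℂ)) := by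
      rw [← Finset.prod_div_distrib]
      refine Finset.prod_congr rfl fun j _ => ?_
      congr 1 <;> ring
    simp only [Pi.div_apply]
    rw [scaledProd, hprod, Complex.GammaSeq, Complex.GammaSeq, Finset.prod_range_succ,
      Finset.prod_range_succ, e1]
    have h4 : (1 + (s + 1) * (n : ℂ)⁻¹) / (1 - s * (n : ℂ)⁻¹) = (n + 1 + s) / (n - s) := by
      rw [div_eq_div_iff _ hns]
      · field_simp
        ring
      · intro h
        apply hns
        field_simp at h
        simpa using h
    rw [h4]
    have hns' : -s + (n : ℂ) ≠ 0 := by rwa [neg_add_eq_sub]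
    have hd' : s + 1 + (n : ℂ) ≠ 0 := by convert hd using 1; ring
    field_simp
    ring

/-! ### Limit function and locally uniform rate -/

/-- The limit of `k ^ (2 s + 1) * versineIntegral k 0 s` as `k → ∞`. -/
noncomputable def versineLimit (s : ℂ) : ℂ :=
  -(2 ^ (-s) * Complex.Gamma (2 * s + 1) * Complex.sin (Real.pi * s))

lemma two_mul_add_one_re_pos {s : ℂ} (hs : -(1 / 2) < s.re) : 0 < (2 * s + 1).re := by
  simp; linarith

lemma hasDerivAt_versineLimit {s : ℂ} (hs : -(1 / 2) < s.re) :
    HasDerivAt versineLimit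
      (-((2 ^ (-s) * (Complex.log 2 * -1) * Complex.Gamma (2 * s + 1)
          + 2 ^ (-s) * (deriv Complex.Gamma (2 * s + 1) * 2)) * Complex.sin (Real.pi * s)
        + 2 ^ (-s) * Complex.Gamma (2 * s + 1) * (Complex.cos (Real.pi * s) * Real.pi))) s := by
  have hG : DifferentiableAt ℂ Complex.Gamma (2 * s + 1) :=
    Complex.differentiableAt_Gamma _ fun m h => by
      have h1 := two_mul_add_one_re_pos hs
      rw [h, Complex.neg_re, Complex.natCast_re] at h1
      have : (0 : ℝ) ≤ m := m.cast_nonneg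
      linarith
  have h1 : HasDerivAt (fun z : ℂ => 2 * z + 1) 2 s := by
    simpa using ((hasDerivAt_id s).const_mul 2).add_const 1
  have h2 := HasDerivAt.comp s hG.hasDerivAt h1
  have h3 : HasDerivAt (fun z : ℂ => (2 : ℂ) ^ (-z)) (2 ^ (-s) * Complex.log 2 * -1) s :=
    (hasDerivAt_id s).neg.const_cpow (Or.inl two_ne_zero)
  have h4 : HasDerivAt (fun z : ℂ => Complex.sin (Real.pi * z))
      (Complex.cos (Real.pi * s) * Real.pi) s := by
    have := ((hasDerivAt_id s).const_mul (Real.pi : ℂ)).csin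
    simpa using this
  rw [mul_assoc] at h3
  exact ((h3.mul h2).mul h4).neg

/-- Legendre's duplication formula merges `Γ(s + 1/2) Γ(s + 1)` into `Γ(2s + 1)`. -/
lemma versineIntegral_zero_mul_limit {s : ℂ} (hs : -(1 / 2) < s.re) :
    versineIntegral 0 0 s * -(Complex.sin (Real.pi * s) * Complex.Gamma (s + 1) ^ 2 / Real.pi) =
      versineLimit s := by
  have hG : Complex.Gamma (s + 1) ≠ 0 := Complex.Gamma_ne_zero_of_re_pos
    (by simp only [Complex.add_re, Complex.one_re]; linarith)
  have hpi : (Real.pi : ℂ) ≠ 0 := Complex.ofReal_ne_zero.2 Real.pi_ne_zero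
  have hsq : (√Real.pi : ℂ) * √Real.pi = Real.pi := by
    rw [← Complex.ofReal_mul, Real.mul_self_sqrt Real.pi_pos.le]
  have hdup := Complex.Gamma_mul_Gamma_add_half (s + 1 / 2)
  rw [show s + 1 / 2 + 1 / 2 = s + 1 by ring, show 2 * (s + 1 / 2) = 2 * s + 1 by ring,
    show 1 - (2 * s + 1) = -s + -s by ring, Complex.cpow_add _ _ two_ne_zero] at hdup
  have h2 : (2 : ℂ) ^ s * 2 ^ (-s) = 1 := by
    rw [← Complex.cpow_add _ _ two_ne_zero, add_neg_cancel, Complex.cpow_zero]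
  rw [versineIntegral_zero_zero hs, versineLimit]
  have hs0 : (√Real.pi : ℂ) ≠ 0 := fun h => hpi (by rw [← hsq, h, zero_mul])
  generalize Complex.sin (Real.pi * s) = S
  generalize (√Real.pi : ℂ) = q at *
  generalize Complex.Gamma (s + 1 / 2) = G₁ at *
  generalize Complex.Gamma (s + 1) = G₂ at *
  generalize Complex.Gamma (2 * s + 1) = G₃ at *
  generalize (2 : ℂ) ^ s = a at *
  generalize (2 : ℂ) ^ (-s) = b at *
  rw [← hsq]
  field_simp
  linear_combination (-(a * S)) * hdup - b * G₃ * q * S * h2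

lemma cpow_mul_versineIntegral (k : ℕ) {s : ℂ} (hs : -(1 / 2) < s.re) :
    (k : ℂ) ^ (2 * s + 1) * versineIntegral k 0 s = versineIntegral 0 0 s * scaledProd k s := by
  rw [versineIntegral_eq_prod k hs, scaledProd]
  ring

lemma continuousOn_scaledProd {k : ℕ} (hk : k ≠ 0) :
    ContinuousOn (scaledProd k) {z : ℂ | -(1 / 2) < z.re} := by
  refine ContinuousOn.mul ?_ (continuousOn_finsetProd _ fun j _ => ?_)
  · exact ContinuousOn.const_cpow (by fun_prop) (Or.inl (by exact_mod_cast hk))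
  · exact ContinuousOn.div (by fun_prop) (by fun_prop) fun z hz => add_natCast_ne_zero hz j

lemma exists_norm_cpow_mul_versineIntegral_sub_le {K : Set ℂ} (hK : IsCompact K)
    (hKs : K ⊆ {z : ℂ | -(1 / 2) < z.re}) :
    ∃ C : ℝ, ∃ m : ℕ, ∀ k, m ≤ k → ∀ z ∈ K,
      ‖(k : ℂ) ^ (2 * z + 1) * versineIntegral k 0 z - versineLimit z‖ ≤ C / k := by
  obtain ⟨R, hR⟩ := hK.isBounded.exists_norm_le
  wlog hR0 : 0 ≤ R generalizing R
  · exact this (max R 0) (fun z hz => (hR z hz).trans (le_max_left _ _)) (le_max_right _ _)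
  -- Past `2R + 1` the step bound holds for every point of `K` at once, so one starting index serves
  -- all of `K`.
  obtain ⟨m, hm⟩ := exists_nat_ge (2 * R + 1)
  have hm1 : 1 ≤ m := by
    have : (1 : ℝ) ≤ m := by linarith
    exact_mod_cast this
  obtain ⟨B₀, hB₀⟩ := hK.exists_bound_of_continuousOn
    ((differentiableOn_versineIntegral 0 0).continuousOn.mono hKs)
  obtain ⟨B₁, hB₁⟩ := hK.exists_bound_of_continuousOn
    ((continuousOn_scaledProd (k := m) (by omega)).mono hKs)
  set A : ℝ := (2 * R + 1) * R + 2 * ((2 * R + 1) ^ 2 + (2 * R + 1)) with hA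
  have hA0 : 0 ≤ A := by positivity
  refine ⟨B₀ * (2 * A * (B₁ * Real.exp (2 * A))), m, fun k hk z hz => ?_⟩
  have hz' := hKs hz
  have h := norm_sub_limit_le_of_relative_step hA0 hm1 (fun k hk =>
    norm_scaledProd_succ_sub_le hz' (hR z hz) (hm1.trans hk)
      (hm.trans (by exact_mod_cast hk))) (tendsto_scaledProd hz') hk
  rw [cpow_mul_versineIntegral k hz', ← versineIntegral_zero_mul_limit hz', ← mul_sub, norm_mul]
  refine (mul_le_mul (hB₀ z hz) (h.trans ?_) (norm_nonneg _)
    ((norm_nonneg _).trans (hB₀ z hz))).trans (mul_div_assoc _ _ _).ge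
  gcongr
  exact hB₁ z hz

lemma differentiableOn_cpow_mul_versineIntegral {k : ℕ} (hk : k ≠ 0) :
    DifferentiableOn ℂ (fun z => (k : ℂ) ^ (2 * z + 1) * versineIntegral k 0 z)
      {z : ℂ | -(1 / 2) < z.re} := by
  refine DifferentiableOn.mul ?_ (differentiableOn_versineIntegral k 0)
  exact DifferentiableOn.const_cpow (by fun_prop) (Or.inl (by exact_mod_cast hk))

lemma differentiableOn_versineLimit :
    DifferentiableOn ℂ versineLimit {z : ℂ | -(1 / 2) < z.re} :=
  fun _ hz => (hasDerivAt_versineLimit hz).differentiableAt.differentiableWithinAt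

/-- Cauchy's estimate on a small circle: the uniform rate on a closed disc passes to derivatives at
its centre, at the cost of `n!/r^n`. -/
lemma iteratedDeriv_cpow_mul_versineIntegral_sub_isBigO {s : ℂ} (hs : -(1 / 2) < s.re) (n : ℕ) :
    (fun k : ℕ => iteratedDeriv n (fun z => (k : ℂ) ^ (2 * z + 1) * versineIntegral k 0 z) s
      - iteratedDeriv n versineLimit s) =O[atTop] fun k : ℕ => (1 : ℝ) / k := by
  obtain ⟨r, hr, hsub⟩ := Metric.nhds_basis_closedBall.mem_iff.1 (isOpen_halfPlane.mem_nhds hs)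
  obtain ⟨C, m, hC⟩ := exists_norm_cpow_mul_versineIntegral_sub_le
    (isCompact_closedBall s r) hsub
  refine Asymptotics.IsBigO.of_bound (n.factorial * C / r ^ n) ?_
  filter_upwards [eventually_ge_atTop m, eventually_ne_atTop 0] with k hk hk0
  have hd := differentiableOn_cpow_mul_versineIntegral hk0
  have hcd : ∀ {f : ℂ → ℂ}, DifferentiableOn ℂ f {z : ℂ | -(1 / 2) < z.re} → ContDiffAt ℂ n f s :=
    fun h => (h.analyticAt (isOpen_halfPlane.mem_nhds hs)).contDiffAt
  rw [← iteratedDeriv_fun_sub (hcd hd) (hcd differentiableOn_versineLimit)]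
  refine (Complex.norm_iteratedDeriv_le_of_forall_mem_sphere_norm_le n hr
    ((hd.sub differentiableOn_versineLimit).diffContOnCl_ball hsub)
    fun z hz => hC k hk z (Metric.sphere_subset_closedBall hz)).trans (le_of_eq ?_)
  rw [Real.norm_of_nonneg (by positivity)]
  ring

/-! ### Leibniz expansion in powers of `log k` -/

lemma iteratedDeriv_cpow_neg {k : ℕ} (hk : k ≠ 0) (n : ℕ) (s : ℂ) :
    iteratedDeriv n (fun z : ℂ => (k : ℂ) ^ (-(2 * z + 1))) s =
      ((-2 * Real.log k : ℝ) : ℂ) ^ n * (k : ℂ) ^ (-(2 * s + 1)) := by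
  induction n generalizing s with
  | zero => simp
  | succ n ih =>
    rw [iteratedDeriv_succ, funext ih]
    have h1 : HasDerivAt (fun z : ℂ => -(2 * z + 1)) (-(2 * 1)) s :=
      (((hasDerivAt_id s).const_mul 2).add_const 1).neg
    have h2 := (h1.const_cpow (c := (k : ℂ)) (Or.inl (by exact_mod_cast hk))).const_mul
      (((-2 * Real.log k : ℝ) : ℂ) ^ n)
    rw [h2.deriv, ← Complex.natCast_log]
    push_cast
    ring

lemma versineIntegral_eq_sum {k : ℕ} (hk : k ≠ 0) (n : ℕ) {s : ℂ} (hs : -(1 / 2) < s.re) :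
    versineIntegral k n s = (k : ℂ) ^ (-(2 * s + 1)) * ∑ i ∈ Finset.range (n + 1),
      n.choose i * ((-2 * Real.log k : ℝ) : ℂ) ^ i *
        iteratedDeriv (n - i) (fun z => (k : ℂ) ^ (2 * z + 1) * versineIntegral k 0 z) s := by
  have hk' : (k : ℂ) ≠ 0 := by exact_mod_cast hk
  have hfac : versineIntegral k 0 = fun z => (k : ℂ) ^ (-(2 * z + 1)) *
      ((k : ℂ) ^ (2 * z + 1) * versineIntegral k 0 z) := by
    funext z
    rw [← mul_assoc, ← Complex.cpow_add _ _ hk', neg_add_cancel, Complex.cpow_zero, one_mul]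
  rw [← iteratedDeriv_versineIntegral k n hs]
  conv_lhs => rw [hfac]
  rw [iteratedDeriv_fun_mul, Finset.mul_sum]
  · refine Finset.sum_congr rfl fun i _ => ?_
    rw [iteratedDeriv_cpow_neg hk]
    ring
  · refine AnalyticAt.contDiffAt (DifferentiableOn.analyticAt (s := univ) ?_ univ_mem)
    exact DifferentiableOn.const_cpow (by fun_prop) (Or.inl hk')
  · exact ((differentiableOn_cpow_mul_versineIntegral hk).analyticAt
      (isOpen_halfPlane.mem_nhds hs)).contDiffAt

lemma eventually_one_le_log : ∀ᶠ k : ℕ in atTop, 1 ≤ Real.log k :=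
  (Real.tendsto_log_atTop.comp tendsto_natCast_atTop_atTop).eventually_ge_atTop 1

lemma log_pow_isBigO_zpow {i : ℕ} {m : ℤ} (h : (i : ℤ) ≤ m) :
    (fun k : ℕ => (((-2 * Real.log k : ℝ) : ℂ)) ^ i) =O[atTop] fun k : ℕ => Real.log k ^ m := by
  refine Asymptotics.IsBigO.of_bound (2 ^ i) ?_
  filter_upwards [eventually_one_le_log] with k hk
  have h1 : Real.log k ^ i ≤ Real.log k ^ m := by
    rw [← zpow_natCast]
    exact zpow_le_zpow_right₀ hk h
  have h0 : 0 ≤ Real.log k := by linarith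
  have h2 : ‖-2 * Real.log k‖ = 2 * Real.log k := by
    rw [norm_mul, Real.norm_of_nonneg h0]; norm_num
  rw [norm_pow, Complex.norm_real, h2, Real.norm_of_nonneg (zpow_nonneg h0 _), mul_pow]
  gcongr

lemma one_div_isBigO_log_zpow : (fun k : ℕ => (1 : ℝ) / k) =O[atTop]
    fun k : ℕ => Real.log k ^ (-2 : ℤ) := by
  have h : (fun x : ℝ => Real.log x ^ 2) =O[atTop] fun x : ℝ => x := by
    simpa using! (Real.isLittleO_pow_log_id_atTop (n := 2)).isBigO
  have h2 := (h.comp_tendsto tendsto_natCast_atTop_atTop (k := ((↑) : ℕ → ℝ))).inv_rev ?_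
  · simpa [Function.comp_def, zpow_neg] using h2
  · filter_upwards [eventually_one_le_log] with k hk h0
    simp only [Function.comp] at h0
    nlinarith

lemma iteratedDeriv_cpow_mul_versineIntegral_isBigO_one {s : ℂ} (hs : -(1 / 2) < s.re) (n : ℕ) :
    (fun k : ℕ => iteratedDeriv n (fun z => (k : ℂ) ^ (2 * z + 1) * versineIntegral k 0 z) s)
      =O[atTop] fun _ : ℕ => (1 : ℝ) := by
  have h1 := iteratedDeriv_cpow_mul_versineIntegral_sub_isBigO hs n
  have h2 : (fun k : ℕ => (1 : ℝ) / k) =O[atTop] fun _ : ℕ => (1 : ℝ) := by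
    refine Asymptotics.IsBigO.of_bound 1 ?_
    filter_upwards [eventually_ge_atTop 1] with k hk
    have : (1 : ℝ) ≤ k := by exact_mod_cast hk
    rw [Real.norm_of_nonneg (by positivity), norm_one, mul_one, div_le_one (by linarith)]
    exact this
  have h3 : (fun _ : ℕ => iteratedDeriv n versineLimit s) =O[atTop] fun _ : ℕ => (1 : ℝ) :=
    Asymptotics.isBigO_const_const _ one_ne_zero _
  simpa using (h1.trans h2).add h3

lemma versineIntegral_expansion {s : ℂ} (hs : -(1 / 2) < s.re) {μ : ℕ} (hμ : 1 ≤ μ) :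
    (fun k : ℕ => (k : ℂ) ^ (2 * s + 1) * versineIntegral k μ s -
      (((-2 * Real.log k : ℝ) : ℂ) ^ μ * versineLimit s
        + μ * ((-2 * Real.log k : ℝ) : ℂ) ^ (μ - 1) * deriv versineLimit s))
      =O[atTop] fun k : ℕ => Real.log k ^ ((μ : ℤ) - 2) := by
  -- With `μ = n + 1`, the indices `i < n` are those with `i ≤ μ - 2` and go into the error. For `μ
  -- = 1` there are none, and the error exponent is `-1`, hence the integer power.
  obtain ⟨n, rfl⟩ : ∃ n, μ = n + 1 := ⟨μ - 1, by omega⟩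
  set h : ℕ → ℕ → ℂ := fun i k =>
    iteratedDeriv i (fun z => (k : ℂ) ^ (2 * z + 1) * versineIntegral k 0 z) s with hh
  have hsum : (fun k : ℕ => ∑ i ∈ Finset.range n,
      (n + 1).choose i * ((-2 * Real.log k : ℝ) : ℂ) ^ i * h (n + 1 - i) k)
      =O[atTop] fun k : ℕ => Real.log k ^ (((n + 1 : ℕ) : ℤ) - 2) := by
    refine Asymptotics.IsBigO.fun_sum fun i hi => ?_
    have hi' := Finset.mem_range.1 hi
    simpa using ((log_pow_isBigO_zpow (m := ((n + 1 : ℕ) : ℤ) - 2) (by omega)).const_mul_left _).mul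
      (iteratedDeriv_cpow_mul_versineIntegral_isBigO_one hs (n + 1 - i))
  -- Replacing a derivative by its limit costs `log^i k / k` with `i ≤ μ`, which is `O(log^(μ-2) k)`
  -- because `1/k = O(log^(-2) k)`.
  have htop : ∀ i j : ℕ, i ≤ n + 1 → (fun k : ℕ => (((-2 * Real.log k : ℝ) : ℂ)) ^ i *
      (h j k - iteratedDeriv j versineLimit s))
      =O[atTop] fun k : ℕ => Real.log k ^ (((n + 1 : ℕ) : ℤ) - 2) := by
    intro i j hi
    have h1 := (log_pow_isBigO_zpow (i := i) (m := ((n + 1 : ℕ) : ℤ)) (by omega)).mul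
      ((iteratedDeriv_cpow_mul_versineIntegral_sub_isBigO hs j).trans one_div_isBigO_log_zpow)
    refine h1.congr' (EventuallyEq.refl _ _) ?_
    filter_upwards [eventually_one_le_log] with k hk
    rw [← zpow_add₀ (by linarith), sub_eq_add_neg]
  refine ((hsum.add ((htop n 1 (by omega)).const_mul_left ((n + 1 : ℕ) : ℂ))).add
    (htop (n + 1) 0 le_rfl)).congr' ?_ (EventuallyEq.refl _ _)
  filter_upwards [eventually_ne_atTop 0] with k hk
  have hk' : (k : ℂ) ≠ 0 := by exact_mod_cast hk
  rw [versineIntegral_eq_sum hk (n + 1) hs, ← mul_assoc ((k : ℂ) ^ _), ← Complex.cpow_add _ _ hk',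
    add_neg_cancel, Complex.cpow_zero, one_mul, Finset.sum_range_succ, Finset.sum_range_succ]
  simp only [hh, Nat.choose_self, Nat.choose_succ_self_right, Nat.sub_self, iteratedDeriv_zero,
    iteratedDeriv_one, Nat.add_sub_cancel, Nat.add_sub_cancel_left, Nat.cast_one]
  ring

/-- A cruder bound suffices for remainders: the logarithms are absorbed by an arbitrarily small
power of `k`. -/
lemma versineIntegral_isBigO {s : ℂ} (hs : -(1 / 2) < s.re) (n : ℕ) {p : ℝ}
    (hp : p < 2 * s.re + 1) :
    (fun k : ℕ => versineIntegral k n s) =O[atTop] fun k : ℕ => (k : ℝ) ^ (-p) := by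
  have hsum : (fun k : ℕ => ∑ i ∈ Finset.range (n + 1),
      n.choose i * ((-2 * Real.log k : ℝ) : ℂ) ^ i *
        iteratedDeriv (n - i) (fun z => (k : ℂ) ^ (2 * z + 1) * versineIntegral k 0 z) s)
      =O[atTop] fun k : ℕ => Real.log k ^ (n : ℤ) := by
    refine Asymptotics.IsBigO.fun_sum fun i hi => ?_
    have hi' := Finset.mem_range.1 hi
    simpa using ((log_pow_isBigO_zpow (m := (n : ℤ)) (by omega)).const_mul_left _).mul
      (iteratedDeriv_cpow_mul_versineIntegral_isBigO_one hs (n - i))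
  have hlog : (fun k : ℕ => Real.log k ^ (n : ℤ)) =O[atTop]
      fun k : ℕ => (k : ℝ) ^ (2 * s.re + 1 - p) := by
    have := (isLittleO_log_rpow_rpow_atTop (n : ℝ) (by linarith : 0 < 2 * s.re + 1 - p)).isBigO
    simpa [Function.comp_def] using this.comp_tendsto tendsto_natCast_atTop_atTop
  have hpow : (fun k : ℕ => (k : ℂ) ^ (-(2 * s + 1))) =O[atTop]
      fun k : ℕ => (k : ℝ) ^ (-(2 * s.re + 1)) := by
    refine Asymptotics.IsBigO.of_bound 1 ?_
    filter_upwards [eventually_gt_atTop 0] with k hk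
    rw [Complex.norm_natCast_cpow_of_pos hk, one_mul, Real.norm_of_nonneg (by positivity)]
    simp
  refine (hpow.mul (hsum.trans hlog)).congr' ?_ ?_
  · filter_upwards [eventually_ne_atTop 0] with k hk
    rw [versineIntegral_eq_sum hk n hs]
  · filter_upwards [eventually_gt_atTop 0] with k hk
    rw [← Real.rpow_add (by exact_mod_cast hk)]
    congr 1
    ring

/-! ### Decay of Fourier coefficients of smooth integrands -/

lemma periodic_deriv {r : ℝ → ℂ} {c : ℝ} (hr : Function.Periodic r c) :
    Function.Periodic (deriv r) c := fun x => by
  rw [← deriv_comp_add_const, funext hr]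

/-- Repeated integration by parts; periodicity cancels the boundary terms, and each round gains
`1/k`. -/
lemma exists_norm_integral_periodic_mul_exp_le {M : ℕ} {r : ℝ → ℂ} (hr : ContDiff ℝ M r)
    (hper : Function.Periodic r (2 * Real.pi)) :
    ∃ C : ℝ, ∀ k : ℕ, 1 ≤ k →
      ‖∫ t in -Real.pi..Real.pi, r t * Complex.exp (k * t * Complex.I)‖ ≤ C / (k : ℝ) ^ M := by
  induction M generalizing r with
  | zero =>
    obtain ⟨B, hB⟩ := isCompact_Icc.exists_bound_of_continuousOn
      (s := Icc (-Real.pi) Real.pi) hr.continuous.continuousOn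
    refine ⟨B * |Real.pi - -Real.pi|, fun k _ => ?_⟩
    rw [pow_zero, div_one]
    refine intervalIntegral.norm_integral_le_of_norm_le_const fun t ht => ?_
    rw [uIoc_of_le (by linarith [Real.pi_pos])] at ht
    have h1 : ‖Complex.exp (k * t * Complex.I)‖ = 1 := by
      simpa using Complex.norm_exp_ofReal_mul_I (k * t)
    rw [norm_mul, h1, mul_one]
    exact hB t (Ioc_subset_Icc_self ht)
  | succ M ih =>
    have hr' : ContDiff ℝ (M + 1) r := by exact_mod_cast hr
    have hd := contDiff_succ_iff_deriv.1 hr'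
    obtain ⟨C, hC⟩ := ih (r := deriv r) hd.2.2 (periodic_deriv hper)
    refine ⟨C, fun k hk => ?_⟩
    have hk0 : (k : ℂ) ≠ 0 := by exact_mod_cast (by omega : k ≠ 0)
    have hkpos : (0 : ℝ) < k := by exact_mod_cast hk
    set v : ℝ → ℂ := fun t => Complex.exp (k * t * Complex.I) / (k * Complex.I) with hv
    have hvd : ∀ t : ℝ, HasDerivAt v (Complex.exp (k * t * Complex.I)) t := by
      intro t
      have h1 : HasDerivAt (fun t : ℝ => (k : ℂ) * t * Complex.I) (k * 1 * Complex.I) t :=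
        ((Complex.ofRealCLM.hasDerivAt (x := t)).const_mul (k : ℂ)).mul_const Complex.I
      refine (h1.cexp.div_const (k * Complex.I)).congr_deriv ?_
      rw [mul_one]
      exact mul_div_cancel_right₀ _ (mul_ne_zero hk0 Complex.I_ne_zero)
    have hparts := intervalIntegral.integral_mul_deriv_eq_deriv_mul (a := -Real.pi) (b := Real.pi)
      (u := r) (v := v) (u' := deriv r) (v' := fun t => Complex.exp (k * t * Complex.I))
      (fun t _ => (hd.1 t).hasDerivAt) (fun t _ => hvd t)
      (hd.2.2.continuous.intervalIntegrable _ _)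
      ((by fun_prop : Continuous fun t : ℝ => Complex.exp (k * t * Complex.I)).intervalIntegrable
        _ _)
    have hrpi : r Real.pi = r (-Real.pi) := by
      rw [← hper (-Real.pi)]; congr 1; ring
    have hvpi : v Real.pi = v (-Real.pi) := by
      simp only [hv]
      congr 1
      rw [Complex.exp_eq_exp_iff_exists_int]
      exact ⟨k, by push_cast; ring⟩
    rw [hparts, hrpi, hvpi, sub_self, zero_sub, norm_neg]
    have hfold : ∀ t : ℝ, deriv r t * v t =
        (deriv r t * Complex.exp (k * t * Complex.I)) / (k * Complex.I) := fun t => by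
      rw [hv, mul_div_assoc]
    simp_rw [hfold]
    rw [intervalIntegral.integral_div, norm_div, norm_mul, Complex.norm_I, mul_one,
      Complex.norm_natCast, pow_succ, ← div_div]
    gcongr
    exact hC k hk

lemma exists_abs_integral_even_mul_cos_le {M : ℕ} {r : ℝ → ℝ} (hr : ContDiff ℝ M r)
    (hper : Function.Periodic r (2 * Real.pi)) (heven : Function.Even r) :
    ∃ C : ℝ, ∀ k : ℕ, 1 ≤ k →
      |∫ t in Ioo 0 Real.pi, r t * Real.cos (k * t)| ≤ C / (k : ℝ) ^ M := by
  obtain ⟨C, hC⟩ := exists_norm_integral_periodic_mul_exp_le (M := M) (r := fun t => (r t : ℂ))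
    (Complex.ofRealCLM.contDiff.comp hr) (fun t => by simp only [hper t])
  refine ⟨C, fun k hk => ?_⟩
  have hcont : Continuous fun t : ℝ => r t * Real.cos (k * t) :=
    hr.continuous.mul (by fun_prop)
  have hsymm : ∫ t in -Real.pi..0, r t * Real.cos (k * t) =
      ∫ t in 0..Real.pi, r t * Real.cos (k * t) := by
    have := intervalIntegral.integral_comp_neg (a := 0) (b := Real.pi)
      (fun t => r t * Real.cos (k * t))
    rw [neg_zero] at this
    rw [← this]
    refine intervalIntegral.integral_congr fun t _ => ?_
    simp only [heven t, mul_neg, Real.cos_neg]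
  have hsplit := intervalIntegral.integral_add_adjacent_intervals
    (hcont.intervalIntegrable (μ := volume) (-Real.pi) 0) (hcont.intervalIntegrable 0 Real.pi)
  have hre : ∫ t in -Real.pi..Real.pi, r t * Real.cos (k * t) =
      (∫ t in -Real.pi..Real.pi, (r t : ℂ) * Complex.exp (k * t * Complex.I)).re := by
    have hc : Continuous fun t : ℝ => (r t : ℂ) * Complex.exp (k * t * Complex.I) :=
      (Complex.continuous_ofReal.comp hr.continuous).mul (by fun_prop)
    have := Complex.reCLM.intervalIntegral_comp_comm
      (hc.intervalIntegrable (μ := volume) (-Real.pi) Real.pi)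
    simp only [Complex.reCLM_apply] at this
    rw [← this]
    refine intervalIntegral.integral_congr fun t _ => ?_
    have h1 : (Complex.exp (k * t * Complex.I)).re = Real.cos (k * t) := by
      simpa using Complex.exp_ofReal_mul_I_re (k * t)
    simp only [Complex.re_ofReal_mul, h1]
  rw [← integral_Ioc_eq_integral_Ioo, ← intervalIntegral.integral_of_le Real.pi_pos.le]
  have h2 := (Complex.abs_re_le_norm _).trans (hC k hk)
  rw [← hre, ← hsplit, hsymm, ← two_mul, abs_mul, abs_two] at h2
  linarith [abs_nonneg (∫ t in 0..Real.pi, r t * Real.cos (k * t))]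

lemma continuous_rpow_mul_log_pow {a : ℝ} (ha : 0 < a) (j : ℕ) :
    Continuous fun x : ℝ => x ^ a * Real.log x ^ j := by
  rw [continuous_iff_continuousAt]
  intro x
  rcases eq_or_ne x 0 with rfl | hx
  · set η : ℝ := a / (2 * (j + 1)) with hη
    have hη0 : 0 < η := by positivity
    have hpos : 0 < a - j * η := by
      have : j * η ≤ a / 2 := by
        rw [hη, mul_div_assoc', div_le_div_iff₀ (by positivity) (by norm_num)]
        nlinarith
      linarith
    set A : ℝ := (1 + 4 ^ η) / η
    rw [ContinuousAt, Real.zero_rpow ha.ne', zero_mul]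
    have hlim : Tendsto (fun x : ℝ => A ^ j * |x| ^ (a - j * η)) (𝓝 0) (𝓝 0) := by
      have hc : Continuous fun x : ℝ => A ^ j * |x| ^ (a - j * η) :=
        continuous_const.mul (continuous_abs.rpow_const fun _ => Or.inr hpos.le)
      have := hc.tendsto 0
      rwa [abs_zero, Real.zero_rpow hpos.ne', mul_zero] at this
    refine squeeze_zero_norm' ?_ hlim
    filter_upwards [Metric.ball_mem_nhds (0 : ℝ) one_pos] with x hx
    rw [mem_ball_zero_iff, Real.norm_eq_abs] at hx
    rcases eq_or_ne x 0 with rfl | hx0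
    · simp [Real.zero_rpow ha.ne', Real.zero_rpow hpos.ne']
    have hxp : 0 < |x| := abs_pos.2 hx0
    rw [norm_mul, norm_pow, Real.norm_eq_abs, Real.norm_eq_abs, ← Real.log_abs]
    calc |x ^ a| * |Real.log (|x|)| ^ j ≤ |x| ^ a * (A * |x| ^ (-η)) ^ j := by
          gcongr
          · exact Real.abs_rpow_le_abs_rpow x a
          · exact abs_log_le_rpow_neg hη0 hxp (by linarith)
      _ = A ^ j * |x| ^ (a - j * η) := by
          rw [mul_pow, ← Real.rpow_natCast (|x| ^ (-η)), ← Real.rpow_mul hxp.le, mul_left_comm,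
            ← Real.rpow_add hxp]
          congr 2
          ring
  · exact (Real.continuousAt_rpow_const x a (Or.inl hx)).mul ((Real.continuousAt_log hx).pow j)

/-- The derivative has the same shape with exponent `a - 1`, so smoothness follows by induction. At
`j = 0` the truncated `j - 1` is harmless because its coefficient vanishes. -/
lemma hasDerivAt_rpow_mul_log_pow {a : ℝ} (ha : 1 < a) (j : ℕ) (x : ℝ) :
    HasDerivAt (fun x : ℝ => x ^ a * Real.log x ^ j)
      (a * (x ^ (a - 1) * Real.log x ^ j) + j * (x ^ (a - 1) * Real.log x ^ (j - 1))) x := by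
  rcases eq_or_ne x 0 with rfl | hx
  · rw [Real.zero_rpow (by linarith), zero_mul, zero_mul, mul_zero, mul_zero, add_zero,
      hasDerivAt_iff_tendsto_slope]
    have h := (continuous_rpow_mul_log_pow (by linarith : 0 < a - 1) j).tendsto 0
    rw [Real.zero_rpow (by linarith), zero_mul] at h
    refine (h.mono_left nhdsWithin_le_nhds).congr' ?_
    filter_upwards [self_mem_nhdsWithin] with y hy
    have hy0 : y ≠ 0 := hy
    rw [slope_def_field, Real.zero_rpow (by linarith), zero_mul, sub_zero, sub_zero,
      Real.rpow_sub_one hy0]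
    ring
  · refine ((Real.hasDerivAt_rpow_const (p := a) (Or.inl hx)).mul
      ((Real.hasDerivAt_log hx).pow j)).congr_deriv ?_
    rw [Real.rpow_sub_one hx, Pi.pow_apply]
    ring

lemma contDiff_rpow_mul_log_pow {M : ℕ} {a : ℝ} (ha : M < a) (j : ℕ) :
    ContDiff ℝ M fun x : ℝ => x ^ a * Real.log x ^ j := by
  induction M generalizing a j with
  | zero =>
    rw [Nat.cast_zero, contDiff_zero]
    exact continuous_rpow_mul_log_pow (by simpa using ha) j
  | succ M ih =>
    push_cast at ha
    have hM : (0 : ℝ) ≤ M := M.cast_nonneg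
    have hd := hasDerivAt_rpow_mul_log_pow (by linarith : 1 < a) j
    rw [Nat.cast_succ, contDiff_succ_iff_deriv]
    refine ⟨fun x => (hd x).differentiableAt, by simp, ?_⟩
    rw [funext fun x => (hd x).deriv]
    exact (contDiff_const.mul (ih (by linarith) j)).add
      (contDiff_const.mul (ih (by linarith) (j - 1)))

/-! ### Peeling off the analytic factor -/

/-- The integral of `(1 - cos t) ^ δ * log (1 - cos t) ^ μ * h (-cos t) * cos (k t)`
over `(0, π)`. -/
noncomputable def weightedVersineIntegral (δ : ℝ) (μ : ℕ) (h : ℝ → ℝ) (k : ℕ) : ℝ :=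
  ∫ t in Ioo 0 Real.pi, (1 - Real.cos t) ^ δ * Real.log (1 - Real.cos t) ^ μ * h (-Real.cos t)
    * Real.cos (k * t)

lemma neg_cos_mem_Icc (t : ℝ) : -Real.cos t ∈ Icc (-1 : ℝ) 1 :=
  ⟨neg_le_neg (Real.cos_le_one t), by linarith [Real.neg_one_le_cos t]⟩

/-- For `δ > M` the amplitude is an even periodic `C^M` function on the whole line, its singular
points included. -/
lemma weightedVersineIntegral_isBigO_of_lt {M : ℕ} {δ : ℝ} (hδ : M < δ) (μ : ℕ) {h : ℝ → ℝ}
    (hh : ContDiffOn ℝ M h (Icc (-1) 1)) :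
    weightedVersineIntegral δ μ h =O[atTop] fun k : ℕ => (k : ℝ) ^ (-(M : ℝ)) := by
  set r : ℝ → ℝ := fun t =>
    (1 - Real.cos t) ^ δ * Real.log (1 - Real.cos t) ^ μ * h (-Real.cos t) with hr
  have h1 : ContDiff ℝ M fun t : ℝ => 1 - Real.cos t := contDiff_const.sub Real.contDiff_cos
  have h2 : ContDiff ℝ M fun t : ℝ => h (-Real.cos t) := by
    rw [← contDiffOn_univ]
    exact hh.comp Real.contDiff_cos.neg.contDiffOn fun t _ => neg_cos_mem_Icc t
  obtain ⟨C, hC⟩ := exists_abs_integral_even_mul_cos_le (M := M) (r := r)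
    (((contDiff_rpow_mul_log_pow hδ μ).comp h1).mul h2)
    (fun t => by simp only [hr, Real.cos_add_two_pi]) (fun t => by simp only [hr, Real.cos_neg])
  refine Asymptotics.IsBigO.of_bound C ?_
  filter_upwards [eventually_ge_atTop 1] with k hk
  have h3 : ‖(k : ℝ) ^ (-(M : ℝ))‖ = (k : ℝ) ^ (-(M : ℝ)) := Real.norm_of_nonneg (by positivity)
  rw [h3, Real.rpow_neg (by positivity), Real.rpow_natCast, ← div_eq_mul_inv]
  exact hC k hk

lemma exists_analyticOn_eq_add_mul {h : ℝ → ℝ} (hh : AnalyticOn ℝ h (Icc (-1) 1)) :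
    ∃ q : ℝ → ℝ, AnalyticOn ℝ q (Icc (-1) 1) ∧
      ∀ x ∈ Icc (-1 : ℝ) 1, h x = h (-1) + (1 + x) * q x := by
  have hmem : (-1 : ℝ) ∈ Icc (-1 : ℝ) 1 := by norm_num
  obtain ⟨g, hg1, hg⟩ := analyticWithinAt_iff_exists_analyticAt.1 (hh (-1) hmem)
  rw [insert_eq_of_mem hmem] at hg1
  set q : ℝ → ℝ := fun x => if x = -1 then deriv g (-1) else (h x - h (-1)) / (1 + x) with hq
  refine ⟨q, fun x hx => ?_, fun x hx => ?_⟩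
  · rcases eq_or_ne x (-1) with rfl | hx1
    · obtain ⟨p, hp⟩ := hg
      -- Near `-1` the quotient is the divided difference of a local analytic extension, whose power
      -- series is the shifted one.
      have hd : AnalyticAt ℝ (dslope g (-1)) (-1) := ⟨_, hp.has_fpower_series_dslope_fslope⟩
      suffices heq : q =ᶠ[𝓝[Icc (-1) 1] (-1)] dslope g (-1) from
        AnalyticWithinAt.congr_of_eventuallyEq hd.analyticWithinAt heq (heq.eq_of_nhdsWithin hmem)
      filter_upwards [hg1] with y hy
      have h1 := hg1.eq_of_nhdsWithin hmem
      simp only [hq]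
      split_ifs with hy1
      · rw [hy1, dslope_same]
      · rw [dslope_of_ne _ hy1, slope_def_field, hy, h1]
        congr 1
        ring
    · have h1 : AnalyticWithinAt ℝ (fun y => (h y - h (-1)) / (1 + y)) (Icc (-1) 1) x :=
        ((hh x hx).sub analyticWithinAt_const).div
          (analyticWithinAt_const.add analyticWithinAt_id) (fun h0 => hx1 (by
            have h0' : 1 + x = 0 := h0
            linarith))
      refine AnalyticWithinAt.congr_of_eventuallyEq h1 ?_ (if_neg hx1)
      filter_upwards [mem_nhdsWithin_of_mem_nhds (isOpen_ne.mem_nhds hx1)] with y hy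
      simp only [hq, if_neg hy]
  · simp only [hq]
    split_ifs with hx1
    · rw [hx1]; ring
    · have : 1 + x ≠ 0 := fun h0 => hx1 (by linarith)
      field_simp
      ring

lemma integrableOn_weightedVersine {δ : ℝ} (hδ : -(1 / 2) < δ) (μ : ℕ) {h : ℝ → ℝ}
    (hh : ContinuousOn h (Icc (-1) 1)) (k : ℕ) :
    IntegrableOn (fun t => (1 - Real.cos t) ^ δ * Real.log (1 - Real.cos t) ^ μ *
      h (-Real.cos t) * Real.cos (k * t)) (Ioo 0 Real.pi) := by
  obtain ⟨C, p, hC, hp, hle⟩ := exists_rpow_mul_log_pow_le hδ μ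
  obtain ⟨B, hB⟩ := isCompact_Icc.exists_bound_of_continuousOn hh
  have hcont : ContinuousOn (fun t => (1 - Real.cos t) ^ δ * Real.log (1 - Real.cos t) ^ μ *
      h (-Real.cos t) * Real.cos (k * t)) (Ioo 0 Real.pi) := by
    have h1 : ContinuousOn (fun t : ℝ => 1 - Real.cos t) (Ioo 0 Real.pi) := by fun_prop
    refine (((h1.rpow_const fun t ht => Or.inl (one_sub_cos_pos ht).ne').mul
      ((h1.log fun t ht => (one_sub_cos_pos ht).ne').pow μ)).mul ?_).mul (by fun_prop)
    exact hh.comp (by fun_prop) fun t _ => neg_cos_mem_Icc t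
  refine Integrable.mono' ((integrableOn_rpow_Ioo hp).const_mul (C * B))
    (hcont.aestronglyMeasurable measurableSet_Ioo) ?_
  filter_upwards [ae_restrict_mem measurableSet_Ioo] with t ht
  have hy := one_sub_cos_pos ht
  have hBt := hB _ (neg_cos_mem_Icc t)
  have ht0 : 0 < t := ht.1
  rw [norm_mul, norm_mul, norm_mul, norm_pow, Real.norm_of_nonneg (Real.rpow_nonneg hy.le _)]
  calc _ ≤ C * t ^ p * B * 1 := by
        refine mul_le_mul (mul_le_mul (hle t ht) hBt (norm_nonneg _) (by positivity))
          (Real.abs_cos_le_one _) (norm_nonneg _) ?_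
        exact mul_nonneg (by positivity) ((norm_nonneg _).trans hBt)
    _ = _ := by ring

lemma weightedVersineIntegral_one (δ : ℝ) (μ : ℕ) (k : ℕ) :
    ((weightedVersineIntegral δ μ (fun _ => 1) k : ℝ) : ℂ) = versineIntegral k μ δ := by
  rw [weightedVersineIntegral, ← integral_complex_ofReal, versineIntegral]
  refine setIntegral_congr_fun measurableSet_Ioo fun t ht => ?_
  simp only [versineKernel, mul_one, Complex.ofReal_mul, Complex.ofReal_pow,
    Complex.ofReal_cpow (one_sub_cos_pos ht).le]

lemma weightedVersineIntegral_eq_add {δ : ℝ} (hδ : -(1 / 2) < δ) (μ : ℕ) {h q : ℝ → ℝ}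
    (hq : ContinuousOn q (Icc (-1) 1))
    (heq : ∀ x ∈ Icc (-1 : ℝ) 1, h x = h (-1) + (1 + x) * q x) (k : ℕ) :
    weightedVersineIntegral δ μ h k = h (-1) * weightedVersineIntegral δ μ (fun _ => 1) k
      + weightedVersineIntegral (δ + 1) μ q k := by
  simp only [weightedVersineIntegral]
  rw [← integral_const_mul, ← integral_add
    ((integrableOn_weightedVersine hδ μ continuousOn_const k).const_mul _)
    (integrableOn_weightedVersine (by linarith) μ hq k)]
  refine setIntegral_congr_fun measurableSet_Ioo fun t ht => ?_
  have hy := one_sub_cos_pos ht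
  simp only [heq _ (neg_cos_mem_Icc t), Real.rpow_add_one hy.ne']
  ring

lemma weightedVersineIntegral_one_isBigO {δ : ℝ} (hδ : -(1 / 2) < δ) (μ : ℕ) {p : ℝ}
    (hp : p < 2 * δ + 1) :
    weightedVersineIntegral δ μ (fun _ => 1) =O[atTop] fun k : ℕ => (k : ℝ) ^ (-p) := by
  have h := versineIntegral_isBigO (s := (δ : ℂ)) (by simpa using hδ) μ (p := p) (by simpa using hp)
  refine (Asymptotics.IsBigO.of_norm_left ?_)
  refine h.norm_left.congr_left fun k => ?_
  rw [← weightedVersineIntegral_one, Complex.norm_real]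

lemma natCast_rpow_isBigO {a b : ℝ} (h : a ≤ b) :
    (fun k : ℕ => (k : ℝ) ^ a) =O[atTop] fun k : ℕ => (k : ℝ) ^ b := by
  refine Asymptotics.IsBigO.of_bound 1 ?_
  filter_upwards [eventually_ge_atTop 1] with k hk
  have hk1 : (1 : ℝ) ≤ k := by exact_mod_cast hk
  rw [one_mul, Real.norm_of_nonneg (by positivity), Real.norm_of_nonneg (by positivity)]
  exact Real.rpow_le_rpow_of_exponent_le hk1 h

/-- Each subtraction of the value at `-1` leaves a model integral, small enough since `p < 2δ + 1`,
and raises the exponent by one; after `n` rounds it exceeds `M` and the smooth bound applies. -/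
lemma weightedVersineIntegral_isBigO_of_lt_add (n M : ℕ) {δ : ℝ} (hδ : -(1 / 2) < δ)
    (hM : M < δ + n) (μ : ℕ) {h : ℝ → ℝ} (hh : AnalyticOn ℝ h (Icc (-1) 1)) {p : ℝ}
    (hp : p < 2 * δ + 1) (hpM : p ≤ M) :
    weightedVersineIntegral δ μ h =O[atTop] fun k : ℕ => (k : ℝ) ^ (-p) := by
  induction n generalizing δ h with
  | zero =>
    refine (weightedVersineIntegral_isBigO_of_lt (M := M) (by simpa using hM) μ
      (hh.contDiffOn (uniqueDiffOn_Icc (by norm_num)))).trans (natCast_rpow_isBigO ?_)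
    linarith
  | succ n ih =>
    obtain ⟨q, hq, heq⟩ := exists_analyticOn_eq_add_mul hh
    push_cast at hM
    have h1 := (weightedVersineIntegral_one_isBigO hδ μ hp).const_mul_left (h (-1))
    have h2 := ih (δ := δ + 1) (by linarith) (by linarith) hq (by linarith)
    exact (h1.add h2).congr_left fun k =>
      (weightedVersineIntegral_eq_add hδ μ hq.continuousOn heq k).symm

lemma weightedVersineIntegral_isBigO {δ : ℝ} (hδ : -(1 / 2) < δ) (μ : ℕ) {h : ℝ → ℝ}
    (hh : AnalyticOn ℝ h (Icc (-1) 1)) {p : ℝ} (hp : p < 2 * δ + 1) :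
    weightedVersineIntegral δ μ h =O[atTop] fun k : ℕ => (k : ℝ) ^ (-p) := by
  obtain ⟨M, hM⟩ := exists_nat_ge p
  obtain ⟨n, hn⟩ := exists_nat_gt (M - δ)
  exact weightedVersineIntegral_isBigO_of_lt_add n M hδ (by linarith) μ hh hp hM

/-! ### The substitution `x = -cos t` -/

lemma image_neg_cos : (fun t : ℝ => -Real.cos t) '' Ioo 0 Real.pi = Ioo (-1) 1 := by
  ext y
  simp only [mem_image, mem_Ioo]
  constructor
  · rintro ⟨t, ht, rfl⟩
    have h1 := one_sub_cos_pos ht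
    have h2 := Real.cos_lt_cos_of_nonneg_of_le_pi ht.1.le le_rfl ht.2
    rw [Real.cos_pi] at h2
    constructor <;> linarith
  · rintro ⟨h0, h1⟩
    refine ⟨Real.arccos (-y), ⟨Real.arccos_pos.2 (by linarith), ?_⟩, ?_⟩
    · rw [← Real.arccos_neg_one]
      exact Real.strictAntiOn_arccos ⟨le_rfl, by norm_num⟩ ⟨by linarith, by linarith⟩
        (by linarith)
    · rw [Real.cos_arccos (by linarith) (by linarith), neg_neg]

lemma injOn_neg_cos : InjOn (fun t : ℝ => -Real.cos t) (Ioo 0 Real.pi) :=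
  fun _ hx _ hy h => injOn_cos_Ioo hx hy (neg_injective h)

lemma hasDerivWithinAt_neg_cos (t : ℝ) (s : Set ℝ) :
    HasDerivWithinAt (fun t : ℝ => -Real.cos t) (Real.sin t) s t := by
  simpa using! (Real.hasDerivAt_cos t).neg.hasDerivWithinAt

lemma eval_T_neg_cos (k : ℕ) (t : ℝ) :
    (Polynomial.Chebyshev.T ℝ (k : ℤ)).eval (-Real.cos t) = (-1) ^ k * Real.cos (k * t) := by
  rw [← Real.cos_pi_sub, Polynomial.Chebyshev.T_real_cos, Int.cast_natCast, mul_sub,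
    Real.cos_nat_mul_pi_sub]

lemma chebyshev_integrand_neg_cos {δ : ℝ} {μ : ℕ} {f g : ℝ → ℝ}
    (hf : ∀ x ∈ Ioc (-1 : ℝ) 1, f x = (1 + x) ^ δ * Real.log (1 + x) ^ μ * g x) (k : ℕ) {t : ℝ}
    (ht : t ∈ Ioo 0 Real.pi) :
    |Real.sin t| • (f (-Real.cos t) * (Polynomial.Chebyshev.T ℝ (k : ℤ)).eval (-Real.cos t) /
      Real.sqrt (1 - (-Real.cos t) ^ 2)) =
    (-1) ^ k * ((1 - Real.cos t) ^ δ * Real.log (1 - Real.cos t) ^ μ * g (-Real.cos t)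
      * Real.cos (k * t)) := by
  have hsin := Real.sin_pos_of_pos_of_lt_pi ht.1 ht.2
  have hsqrt : Real.sqrt (1 - (-Real.cos t) ^ 2) = Real.sin t := by
    rw [neg_sq, ← Real.sin_sq, Real.sqrt_sq hsin.le]
  rw [hsqrt, eval_T_neg_cos, abs_of_pos hsin, smul_eq_mul, mul_div_cancel₀ _ hsin.ne',
    hf _ ⟨by linarith [one_sub_cos_pos ht], (neg_cos_mem_Icc t).2⟩, ← sub_eq_add_neg]
  ring

lemma intervalIntegrable_chebyshev {δ : ℝ} (hδ : -(1 / 2) < δ) {μ : ℕ} {f g : ℝ → ℝ}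
    (hg : ContinuousOn g (Icc (-1) 1))
    (hf : ∀ x ∈ Ioc (-1 : ℝ) 1, f x = (1 + x) ^ δ * Real.log (1 + x) ^ μ * g x) (k : ℕ) :
    IntervalIntegrable
      (fun x : ℝ => f x * (Polynomial.Chebyshev.T ℝ (k : ℤ)).eval x / Real.sqrt (1 - x ^ 2))
      volume (-1) 1 := by
  rw [intervalIntegrable_iff_integrableOn_Ioo_of_le (by norm_num), ← image_neg_cos,
    integrableOn_image_iff_integrableOn_abs_deriv_smul measurableSet_Ioo
      (fun t _ => hasDerivWithinAt_neg_cos t _) injOn_neg_cos]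
  refine IntegrableOn.congr_fun ((integrableOn_weightedVersine hδ μ hg k).const_mul ((-1) ^ k))
    (fun t ht => ?_) measurableSet_Ioo
  exact (chebyshev_integrand_neg_cos hf k ht).symm

lemma chebyshevCoeff_eq {δ : ℝ} {μ : ℕ} {f g : ℝ → ℝ}
    (hf : ∀ x ∈ Ioc (-1 : ℝ) 1, f x = (1 + x) ^ δ * Real.log (1 + x) ^ μ * g x) (k : ℕ) :
    chebyshevCoeff f k = 2 / Real.pi * ((-1) ^ k * weightedVersineIntegral δ μ g k) := by
  rw [chebyshevCoeff, intervalIntegral.integral_of_le (by norm_num), integral_Ioc_eq_integral_Ioo,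
    ← image_neg_cos, integral_image_eq_integral_abs_deriv_smul measurableSet_Ioo
      (fun t _ => hasDerivWithinAt_neg_cos t _) injOn_neg_cos, weightedVersineIntegral,
    ← integral_const_mul ((-1 : ℝ) ^ k)]
  congr 1
  exact setIntegral_congr_fun measurableSet_Ioo fun t ht => chebyshev_integrand_neg_cos hf k ht

/-! ### Identification of the constants -/

lemma versineLimit_ofReal (δ : ℝ) :
    versineLimit δ =
      ((-(2 ^ (-δ) * Real.Gamma (2 * δ + 1) * Real.sin (δ * Real.pi)) : ℝ) : ℂ) := by
  rw [versineLimit, mul_comm (Real.pi : ℂ)]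
  push_cast
  rw [← Complex.Gamma_ofReal, Complex.ofReal_cpow zero_le_two]
  push_cast
  rfl

lemma deriv_Gamma_ofReal {x : ℝ} (hx : 0 < x) :
    deriv Complex.Gamma x = ((deriv Real.Gamma x : ℝ) : ℂ) := by
  have hne : ∀ m : ℕ, x ≠ -m := fun m h => by
    have : (0 : ℝ) ≤ m := m.cast_nonneg
    linarith
  have h1 : HasDerivAt Complex.Gamma (deriv Complex.Gamma x) x :=
    (Complex.differentiableAt_Gamma _ fun m h => hne m (by exact_mod_cast h)).hasDerivAt
  have h2 := h1.comp_ofReal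
  have h3 := (Real.differentiableAt_Gamma hne).hasDerivAt.ofReal_comp
  simp only [Complex.Gamma_ofReal] at h2
  exact h2.unique h3

lemma deriv_versineLimit_ofReal {δ : ℝ} (hδ : -(1 / 2) < δ) :
    deriv versineLimit δ =
      ((2 ^ (-δ) * (Real.log 2 * Real.Gamma (2 * δ + 1) * Real.sin (δ * Real.pi)
        - 2 * deriv Real.Gamma (2 * δ + 1) * Real.sin (δ * Real.pi)
        - Real.pi * Real.Gamma (2 * δ + 1) * Real.cos (δ * Real.pi)) : ℝ) : ℂ) := by
  rw [(hasDerivAt_versineLimit (s := (δ : ℂ)) (by simpa using hδ)).deriv,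
    show (2 * (δ : ℂ) + 1) = ((2 * δ + 1 : ℝ) : ℂ) by push_cast; rfl,
    deriv_Gamma_ofReal (by linarith), Complex.Gamma_ofReal, mul_comm (Real.pi : ℂ) (δ : ℂ)]
  have h2 : (2 : ℂ) ^ (-(δ : ℂ)) = ((2 ^ (-δ) : ℝ) : ℂ) := by
    rw [Complex.ofReal_cpow zero_le_two]; push_cast; rfl
  have hlog : Complex.log 2 = ((Real.log 2 : ℝ) : ℂ) := by
    rw [Complex.ofReal_log zero_le_two]; push_cast; rfl
  rw [h2, hlog]
  push_cast
  ring

/-- The powers of two and the signs come from `(-2)^μ` and `(-2)^(μ-1)`; in `L'`, `log 2`, `Γ'` and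
the cosine come from differentiating the three factors of `L`. -/
lemma chebyshevTwoTerm_eq {δ : ℝ} (hδ : -(1 / 2) < δ) {μ : ℕ} (hμ : 1 ≤ μ) (c : ℝ) (k : ℕ) :
    ((chebyshevTwoTerm δ μ c k : ℝ) : ℂ) =
      ((2 / Real.pi * ((-1) ^ k * (c * (1 / (k : ℝ) ^ (2 * δ + 1)))) : ℝ) : ℂ) *
      (((-2 * Real.log k : ℝ) : ℂ) ^ μ * versineLimit δ
        + μ * ((-2 * Real.log k : ℝ) : ℂ) ^ (μ - 1) * deriv versineLimit δ) := by
  obtain ⟨n, rfl⟩ : ∃ n, μ = n + 1 := ⟨μ - 1, by omega⟩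
  rw [versineLimit_ofReal, deriv_versineLimit_ofReal hδ]
  rw [← Complex.ofReal_natCast, ← Complex.ofReal_pow, ← Complex.ofReal_pow, ← Complex.ofReal_mul,
    ← Complex.ofReal_mul, ← Complex.ofReal_mul, ← Complex.ofReal_add, ← Complex.ofReal_mul,
    Complex.ofReal_inj]
  have hpi := Real.pi_ne_zero
  have e1 : (2 : ℝ) ^ (((n + 1 : ℕ) : ℝ) + 1 - δ) = 2 ^ n * 4 * 2 ^ (-δ) := by
    rw [show ((n + 1 : ℕ) : ℝ) + 1 - δ = (n : ℝ) + 2 + -δ by push_cast; ring,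
      Real.rpow_add two_pos, Real.rpow_add two_pos, Real.rpow_natCast]
    norm_num
  have e2 : (2 : ℝ) ^ (((n + 1 : ℕ) : ℝ) - δ) = 2 ^ n * 2 * 2 ^ (-δ) := by
    rw [sub_eq_add_neg, Real.rpow_add two_pos, Real.rpow_natCast, pow_succ]
  rw [chebyshevTwoTerm, e1, e2, Nat.add_sub_cancel, mul_pow, mul_pow,
    show (-2 : ℝ) = -1 * 2 by norm_num, mul_pow, mul_pow]
  field_simp
  ring

end ChebyshevLog

open Set MeasureTheory Filter Topology ChebyshevLog in
theorem mainTheorem6 (δ : ℝ) (hδ : -(1 / 2 : ℝ) < δ) (μ : ℕ) (hμ : 1 ≤ μ)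
    (g : ℝ → ℝ) (hg : AnalyticOn ℝ g (Set.Icc (-1) 1))
    (f : ℝ → ℝ) (hf : ∀ x ∈ Set.Ioc (-1 : ℝ) 1, f x = (1 + x) ^ δ * Real.log (1 + x) ^ μ * g x) :
    (∀ k : ℕ, IntervalIntegrable
      (fun x : ℝ => f x * (Polynomial.Chebyshev.T ℝ (k : ℤ)).eval x / Real.sqrt (1 - x ^ 2))
      MeasureTheory.volume (-1) 1) ∧
    (fun k : ℕ => chebyshevCoeff f k - chebyshevTwoTerm δ μ (g (-1)) k)
      =O[Filter.atTop]
        (fun k : ℕ => Real.log k ^ ((μ : ℤ) - 2) / (k : ℝ) ^ (2 * δ + 1)) := by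
  refine ⟨intervalIntegrable_chebyshev hδ hg.continuousOn hf, ?_⟩
  obtain ⟨q, hq, heq⟩ := exists_analyticOn_eq_add_mul hg
  have hsign : (fun k : ℕ => 2 / Real.pi * (-1 : ℝ) ^ k) =O[atTop] fun _ => (1 : ℝ) := by
    refine Asymptotics.IsBigO.of_bound (2 / Real.pi) (Eventually.of_forall fun k => ?_)
    rw [norm_mul, norm_pow, norm_neg, norm_one, one_pow, mul_one, mul_one,
      Real.norm_of_nonneg (by positivity)]
  have hrest : weightedVersineIntegral (δ + 1) μ q =O[atTop]
      fun k : ℕ => Real.log k ^ ((μ : ℤ) - 2) / (k : ℝ) ^ (2 * δ + 1) := by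
    -- The remainder has exponent `δ + 1`, so any `p < 2δ + 3` is allowed; `2δ + 2` gains a full
    -- `1/k`, which beats `log^(μ-2) k` even when that power is negative.
    refine (weightedVersineIntegral_isBigO (by linarith) μ hq
      (p := 2 * δ + 2) (by linarith)).trans ?_
    have h1 : (fun k : ℕ => (1 : ℝ) / k) =O[atTop] fun k : ℕ => Real.log k ^ ((μ : ℤ) - 2) := by
      refine one_div_isBigO_log_zpow.trans (Asymptotics.IsBigO.of_bound 1 ?_)
      filter_upwards [eventually_one_le_log] with k hk
      have h0 : 0 ≤ Real.log k := by linarith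
      rw [one_mul, Real.norm_of_nonneg (zpow_nonneg h0 _), Real.norm_of_nonneg (zpow_nonneg h0 _)]
      exact zpow_le_zpow_right₀ hk (by omega)
    refine (h1.mul (Asymptotics.isBigO_refl
      (fun k : ℕ => ((k : ℝ) ^ (2 * δ + 1))⁻¹) atTop)).congr' ?_ ?_
    · filter_upwards [eventually_gt_atTop 0] with k hk
      have hk0 : (0 : ℝ) < k := by exact_mod_cast hk
      rw [show -(2 * δ + 2) = -1 + -(2 * δ + 1) by ring, Real.rpow_add hk0 (-1), Real.rpow_neg_one,
        Real.rpow_neg hk0.le, one_div]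
    · exact Eventually.of_forall fun k => (div_eq_mul_inv _ _).symm
  have hmain : (fun k : ℕ => 2 / Real.pi * ((-1) ^ k *
      (g (-1) * weightedVersineIntegral δ μ (fun _ => 1) k)) - chebyshevTwoTerm δ μ (g (-1)) k)
      =O[atTop] fun k : ℕ => Real.log k ^ ((μ : ℤ) - 2) / (k : ℝ) ^ (2 * δ + 1) := by
    have h1 := versineIntegral_expansion (s := (δ : ℂ)) (by simpa using hδ) hμ
    have h2 := ((hsign.const_mul_left (g (-1))).mul (Asymptotics.isBigO_refl
      (fun k : ℕ => ((k : ℝ) ^ (2 * δ + 1))⁻¹) atTop)).mul h1.norm_left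
    refine (Asymptotics.IsBigO.of_norm_left (h2.norm_left.congr' ?_ ?_))
    · filter_upwards [eventually_gt_atTop 0] with k hk
      have hk0 : (0 : ℝ) < k := by exact_mod_cast hk
      have hpow : (k : ℂ) ^ (2 * (δ : ℂ) + 1) = (((k : ℝ) ^ (2 * δ + 1) : ℝ) : ℂ) := by
        rw [Complex.ofReal_cpow hk0.le]; push_cast; rfl
      have hpos : (((k : ℝ) ^ (2 * δ + 1) : ℝ) : ℂ) ≠ 0 :=
        Complex.ofReal_ne_zero.2 (by positivity)
      rw [norm_mul, norm_norm, ← Complex.norm_real (_ - chebyshevTwoTerm _ _ _ _),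
        ← Complex.norm_real (_ * _), ← norm_mul, Complex.ofReal_sub, chebyshevTwoTerm_eq hδ hμ,
        hpow, ← weightedVersineIntegral_one]
      congr 1
      push_cast at hpos ⊢
      field_simp
    · exact Eventually.of_forall fun k => by
        simp only [one_mul, mul_comm, div_eq_mul_inv]
  have hsum := hmain.add ((hsign.mul hrest).congr_right fun k => one_mul _)
  refine hsum.congr_left fun k => ?_
  rw [chebyshevCoeff_eq hf, weightedVersineIntegral_eq_add hδ μ hq.continuousOn heq]
  ring
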